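/- **Setting.** Let $f:\mathbf R\to\mathbf R$ be a nonconstant periodic $C^\infty$ function with a period $p>0$, let $n\ge 4$ be an integer, let $V$ be a real vector space of dimension $n-2$ with a pseudo-Euclidean (that is, symmetric nondegenerate bilinear) inner product $\langle\,,\rangle$, and let $A:V\to V$ be a nonzero, traceless, $\langle\,,\rangle$-self-adjoint linear operator. Let $\mathcal E$ be the vector space of all $C^\infty$ solutions $u:\mathbf R\to V$ of $\ddot u(t)=f(t)u(t)+Au(t)$, let $\Omega(u,w)=\langle\dot u,w\rangle-\langle u,\dot w\rangle$ for $u,w\in\mathcal E$ (a constant function of $t$), and let $T:\mathcal E\to\mathcal E$ be the isomorphism $(Tu)(t)=u(t-p)$. The set $G=\mathbf Z\times\mathbf R\times\mathcal E$ is a group with the operation $$(k,q,u)\cdot(l,r,w)=(k+l,\ q+r-\Omega(u,T^lw),\ T^{-l}u+w),$$ and $G$ acts on $\widehat M=\mathbf R^2\times V$ by $$(k,q,u)\cdot(t,s,v)=(t+kp,\ s+q-\langle\dot u(t),2v+u(t)\rangle,\ v+u(t)).$$ Define homomorphisms $\Pi:G\to\mathbf Z$, $\Delta:\operatorname{Ker}\Pi\to\mathcal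 E$ and, for $t\in\mathbf R$, $\Delta_t:\operatorname{Ker}\Pi\to V$ by $\Pi(k,q,u)=k$, $\Delta(0,q,u)=u$, $\Delta_t(0,q,u)=u(t)$. For a subgroup $\Gamma\subset G$ put $$\Sigma=\Gamma\cap\operatorname{Ker}\Pi,\quad \Xi=\Sigma\cap\operatorname{Ker}\Delta,\quad \Lambda=\Delta(\Sigma),\quad \mathcal L=\operatorname{span}\Lambda\subset\mathcal E .$$ Since $\Sigma\subset\{0\}\times\mathbf R\times\mathcal L$, the set $\Sigma$ is also treated as a subset of $\mathbf R\times\mathcal L$. A *first-order subspace* of $\mathcal E$ is an $(n-2)$-dimensional vector subspace in which every nonzero $u$ satisfies $u(t)\ne0$ for all $t\in\mathbf R$; a subspace of $\mathcal E$ is *Lagrangian* if $\Omega(u,w)=0$ for all $u,w$ in it. A *lattice* in a finite-dimensional real vector space is an additive subgroup generated by some basis. A free action of $\Gamma$ on $\widehat M$ is *properly discontinuous* if there is a surjective local $C^\infty$ diffeomorphism $\pi:\widehat M\to M$ onto some (Hausdorff) manifold $M$ such that the $\pi$-preimages of the points of $M$ are precisely the $\Gamma$-orbits; $M=\widehat M/\Gamma$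 is then called the quotient manifold. **Theorem 4.2.** Let $\Gamma$ be a subgroup of $G$ acting on $\widehat M$ freely and properly discontinuously, with a compact quotient manifold $M=\widehat M/\Gamma$. Then: (a) for every $t\in\mathbf R$, the image $\Delta_t(\Sigma)$ spans $V$; (b) $\Sigma\cap\operatorname{Ker}\Delta_t=\Xi$ for every $t\in\mathbf R$; (c) $\Xi=\{(0,l\theta,0):l\in\mathbf Z\}$ for some $\theta\in[0,\infty)$; (d) with $\theta$ as in (c), $2\,\Omega(u,w)\in\mathbf Z\theta$ for all $u,w\in\Lambda$; (e) whenever $(k,q,u)\in\Gamma$, we have $T^k(\Lambda)=\Lambda$, $T^k(\mathcal L)=\mathcal L$, and $\Psi(\Sigma)=\Sigma$, where $\Sigma$ is treated as a subset of $\mathbf R\times\mathcal L$ and $\Psi:\mathbf R\times\mathcal L\to\mathbf R\times\mathcal L$ is given by $\Psi(r,w)=(r-2\,\Omega(u,w),T^kw)$; (f) if $\Gamma$ has an Abelian subgroup of finite index, then $T^k:\mathcal L\to\mathcal L$ is the identity for some $(k,q,u)\in\Gamma$ with $k\ge1$; (g) $\mathcal L$ is a first-order subspace of $\mathcal E$,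 so that $\dim\mathcal L=n-2$; (h) one of the following two cases occurs: (I) $\Xi$ is the trivial group, $\mathcal L$ is a Lagrangian subspace of $\mathcal E$, $\Sigma$ treated as a subset of $\mathbf R\times\mathcal L$ is a lattice in $\mathbf R\times\mathcal L$, and the projection $\mathbf R\times\mathcal L\to\mathcal L$ maps $\Sigma$ isomorphically onto $\Lambda$; (II) $\Xi$ is isomorphic to $\mathbf Z$ and $\Lambda$ is a lattice in $\mathcal L$. -/

import Mathlib

open scoped Manifold ContDiff

noncomputable section

universe u

/-- The data `f, p, n, V, ⟨·,·⟩, A`: a nonconstant smooth periodic function `f : ℝ → ℝ` with a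
period `p > 0`, an integer `n ≥ 4`, a real vector space `V` of dimension `n - 2`, a
pseudo-Euclidean (symmetric, nondegenerate) inner product on `V`, and a nonzero traceless
self-adjoint operator `A` on `V`. The norm of `V` only serves to express its canonical topology
and smooth structure as a finite-dimensional vector space. -/
structure ConformalData (V : Type u) [NormedAddCommGroup V] [NormedSpace ℝ V]
    [FiniteDimensional ℝ V] where
  f : ℝ → ℝ
  p : ℝ
  n : ℕ
  form : LinearMap.BilinForm ℝ V
  A : V →ₗ[ℝ] V
  f_smooth : ContDiff ℝ ∞ f
  f_nonconstant : ¬ ∃ c : ℝ, ∀ t, f t = c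
  f_periodic : Function.Periodic f p
  p_pos : 0 < p
  four_le_n : 4 ≤ n
  finrank_V : Module.finrank ℝ V = n - 2
  form_symm : ∀ v w, form v w = form w v
  form_nondegenerate : form.Nondegenerate
  A_ne_zero : A ≠ 0
  A_trace : LinearMap.trace ℝ V A = 0
  A_selfAdjoint : ∀ v w, form (A v) w = form v (A w)

namespace ConformalData

variable {V : Type u} [NormedAddCommGroup V] [NormedSpace ℝ V] [FiniteDimensional ℝ V]
variable (D : ConformalData V)

/-! ### The solution space, the symplectic form and the translation operator -/

/-- The vector space `𝓔` of all smooth solutions `u : ℝ → V` of `ü(t) = f(t) u(t) + A u(t)`. -/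
def E : Submodule ℝ (ℝ → V) where
  carrier := {u | ContDiff ℝ ∞ u ∧ ∀ t, deriv (deriv u) t = D.f t • u t + D.A (u t)}
  zero_mem' := by
    refine ⟨contDiff_const, fun t => ?_⟩
    have h : deriv (0 : ℝ → V) = 0 := by
      funext s
      simp
    simp [h]
  add_mem' := by
    rintro u w ⟨hu, hu'⟩ ⟨hw, hw'⟩
    refine ⟨hu.add hw, fun t => ?_⟩
    have h : deriv (u + w) = deriv u + deriv w := by
      funext s
      exact deriv_add (hu.differentiable (by simp) s) (hw.differentiable (by simp) s)
    have h2 : ∀ {x : ℝ → V}, ContDiff ℝ ∞ x → DifferentiableAt ℝ (deriv x) t := fun hx =>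
      ((contDiff_infty_iff_deriv.1 hx).2.differentiable (by simp)) t
    rw [h, deriv_add (h2 hu) (h2 hw), hu', hw']
    simp only [Pi.add_apply, smul_add, map_add]
    abel
  smul_mem' := by
    rintro c u ⟨hu, hu'⟩
    refine ⟨contDiff_const.smul hu, fun t => ?_⟩
    have h : deriv (c • u) = c • deriv u := by
      funext s
      exact deriv_const_smul c (hu.differentiable (by simp) s)
    have h2 : DifferentiableAt ℝ (deriv u) t :=
      ((contDiff_infty_iff_deriv.1 hu).2.differentiable (by simp)) t
    rw [h, deriv_const_smul c h2, hu']
    simp only [Pi.smul_apply, smul_add, map_smul, smul_comm c]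

variable {D} in
theorem E.hasDerivAt (u : D.E) (t : ℝ) : HasDerivAt (u : ℝ → V) (deriv (u : ℝ → V) t) t :=
  (u.2.1.differentiable (by simp) t).hasDerivAt

variable {D} in
theorem E.hasDerivAt_deriv (u : D.E) (t : ℝ) :
    HasDerivAt (deriv (u : ℝ → V)) (D.f t • (u : ℝ → V) t + D.A ((u : ℝ → V) t)) t := by
  have h := (((contDiff_infty_iff_deriv.1 u.2.1).2.differentiable (by simp)) t).hasDerivAt
  rwa [u.2.2 t] at h

/-- The function `t ↦ ⟨u̇(t), w(t)⟩ - ⟨u(t), ẇ(t)⟩`. -/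
def wronskian (u w : D.E) (t : ℝ) : ℝ :=
  D.form (deriv (u : ℝ → V) t) ((w : ℝ → V) t) - D.form ((u : ℝ → V) t) (deriv (w : ℝ → V) t)

theorem wronskian_const (u w : D.E) (s t : ℝ) : D.wronskian u w s = D.wronskian u w t := by
  have key : ∀ {x y : ℝ → V} {x' y' : V} {r : ℝ}, HasDerivAt x x' r → HasDerivAt y y' r →
      HasDerivAt (fun r => D.form (x r) (y r)) (D.form x' (y r) + D.form (x r) y') r := by
    intro x y x' y' r hx hy
    have h := (D.form.toContinuousBilinearMap).hasFDerivAt_of_bilinear hx.hasFDerivAt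
      hy.hasFDerivAt
    have h' := h.hasDerivAt
    exact h'.congr_deriv (by simp [add_comm])
  have hd : ∀ r, HasDerivAt (D.wronskian u w) 0 r := by
    intro r
    have h := (key (E.hasDerivAt_deriv u r) (E.hasDerivAt w r)).sub
      (key (E.hasDerivAt u r) (E.hasDerivAt_deriv w r))
    have h0 : D.form (D.f r • (u : ℝ → V) r + D.A ((u : ℝ → V) r)) ((w : ℝ → V) r)
        + D.form (deriv (u : ℝ → V) r) (deriv (w : ℝ → V) r)
        - (D.form (deriv (u : ℝ → V) r) (deriv (w : ℝ → V) r)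
          + D.form ((u : ℝ → V) r) (D.f r • (w : ℝ → V) r + D.A ((w : ℝ → V) r))) = 0 := by
      simp only [map_add, map_smul, LinearMap.add_apply, LinearMap.smul_apply, D.A_selfAdjoint]
      ring
    rw [h0] at h
    exact h
  exact is_const_of_deriv_eq_zero (fun r => (hd r).differentiableAt) (fun r => (hd r).deriv) s t

/-- The skew-symmetric form `Ω(u, w) = ⟨u̇, w⟩ - ⟨u, ẇ⟩` on `𝓔`; the right-hand side is a constant
function of `t`, see `Omega_eq`, and it is evaluated here at `t = 0`. -/
def Omega (u w : D.E) : ℝ := D.wronskian u w 0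

theorem Omega_eq (u w : D.E) (t : ℝ) :
    D.Omega u w = D.form (deriv (u : ℝ → V) t) ((w : ℝ → V) t)
      - D.form ((u : ℝ → V) t) (deriv (w : ℝ → V) t) :=
  D.wronskian_const u w 0 t

theorem deriv_add_coe (u w : D.E) (t : ℝ) :
    deriv ((u + w : D.E) : ℝ → V) t = deriv (u : ℝ → V) t + deriv (w : ℝ → V) t :=
  ((E.hasDerivAt u t).add (E.hasDerivAt w t)).deriv

theorem Omega_add_left (u w x : D.E) : D.Omega (u + w) x = D.Omega u x + D.Omega w x := by
  simp only [D.Omega_eq _ _ 0, D.deriv_add_coe]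
  simp only [Submodule.coe_add, Pi.add_apply, map_add, LinearMap.add_apply]
  ring

theorem Omega_add_right (u w x : D.E) : D.Omega u (w + x) = D.Omega u w + D.Omega u x := by
  simp only [D.Omega_eq _ _ 0, D.deriv_add_coe]
  simp only [Submodule.coe_add, Pi.add_apply, map_add]
  ring

theorem Omega_self (u : D.E) : D.Omega u u = 0 := by
  rw [D.Omega_eq _ _ 0, D.form_symm, sub_self]

theorem Omega_zero_left (u : D.E) : D.Omega 0 u = 0 := by
  have h := D.Omega_add_left 0 0 u
  rw [add_zero] at h
  linarith

theorem Omega_zero_right (u : D.E) : D.Omega u 0 = 0 := by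
  have h := D.Omega_add_right u 0 0
  rw [add_zero] at h
  linarith

theorem Omega_neg_left (u w : D.E) : D.Omega (-u) w = -D.Omega u w := by
  have h := D.Omega_add_left u (-u) w
  rw [add_neg_cancel, D.Omega_zero_left] at h
  linarith

theorem translate_mem {u : ℝ → V} (hu : u ∈ D.E) {c : ℝ} (hc : ∀ t, D.f (t - c) = D.f t) :
    (fun t => u (t - c)) ∈ D.E := by
  refine ⟨hu.1.comp (contDiff_id.sub contDiff_const), fun t => ?_⟩
  have h : deriv (fun t => u (t - c)) = fun t => deriv u (t - c) := by
    funext s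
    rw [deriv_comp_sub_const]
  rw [h, deriv_comp_sub_const, hu.2, hc]

/-- The translation operator `(T u)(t) = u(t - p)` on `𝓔`. -/
def T : D.E ≃ₗ[ℝ] D.E where
  toFun u := ⟨fun t => (u : ℝ → V) (t - D.p), D.translate_mem u.2 fun t => D.f_periodic.sub_eq t⟩
  invFun u := ⟨fun t => (u : ℝ → V) (t - -D.p), D.translate_mem u.2 fun t => by
    rw [sub_neg_eq_add]
    exact D.f_periodic t⟩
  map_add' u w := rfl
  map_smul' c u := rfl
  left_inv u := by
    ext t
    simp
  right_inv u := by
    ext t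
    simp

theorem T_zpow_apply (k : ℤ) (u : D.E) (t : ℝ) :
    ((D.T ^ k) u : ℝ → V) t = (u : ℝ → V) (t - k * D.p) := by
  have h1 : ∀ (w : D.E) (s : ℝ), (D.T w : ℝ → V) s = (w : ℝ → V) (s - D.p) := fun _ _ => rfl
  have h2 : ∀ (w : D.E) (s : ℝ), (D.T⁻¹ w : ℝ → V) s = (w : ℝ → V) (s - -D.p) := fun _ _ => rfl
  induction k using Int.induction_on generalizing u t with
  | zero => simp
  | succ i ih =>
    rw [zpow_add_one, LinearEquiv.mul_apply, ih, h1]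
    exact congrArg (u : ℝ → V) (by push_cast; ring)
  | pred i ih =>
    rw [zpow_sub_one, LinearEquiv.mul_apply, ih, h2]
    exact congrArg (u : ℝ → V) (by push_cast; ring)

theorem deriv_T_zpow_apply (k : ℤ) (u : D.E) (t : ℝ) :
    deriv ((D.T ^ k) u : ℝ → V) t = deriv (u : ℝ → V) (t - k * D.p) := by
  have h : ((D.T ^ k) u : ℝ → V) = fun t => (u : ℝ → V) (t - k * D.p) :=
    funext fun t => D.T_zpow_apply k u t
  rw [h, deriv_comp_sub_const]

theorem Omega_T_zpow (k : ℤ) (u w : D.E) : D.Omega ((D.T ^ k) u) ((D.T ^ k) w) = D.Omega u w := by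
  rw [D.Omega_eq _ _ 0, D.Omega_eq u w (0 - k * D.p)]
  simp only [D.deriv_T_zpow_apply, D.T_zpow_apply]

/-! ### The group `G` and its action on `ℝ² × V` -/

/-- The underlying set `ℤ × ℝ × 𝓔` of the group `G`. -/
@[ext]
structure G where
  k : ℤ
  q : ℝ
  u : D.E

namespace G

variable {D}

instance : Mul D.G where
  mul a b := ⟨a.k + b.k, a.q + b.q - D.Omega a.u ((D.T ^ b.k) b.u), (D.T ^ (-b.k)) a.u + b.u⟩

instance : One D.G where
  one := ⟨0, 0, 0⟩

instance : Inv D.G where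
  inv a := ⟨-a.k, -a.q, -(D.T ^ a.k) a.u⟩

@[simp] theorem mul_k (a b : D.G) : (a * b).k = a.k + b.k := rfl

@[simp] theorem mul_q (a b : D.G) :
    (a * b).q = a.q + b.q - D.Omega a.u ((D.T ^ b.k) b.u) := rfl

@[simp] theorem mul_u (a b : D.G) : (a * b).u = (D.T ^ (-b.k)) a.u + b.u := rfl

@[simp] theorem one_k : (1 : D.G).k = 0 := rfl

@[simp] theorem one_q : (1 : D.G).q = 0 := rfl

@[simp] theorem one_u : (1 : D.G).u = 0 := rfl

@[simp] theorem inv_k (a : D.G) : a⁻¹.k = -a.k := rfl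

@[simp] theorem inv_q (a : D.G) : a⁻¹.q = -a.q := rfl

@[simp] theorem inv_u (a : D.G) : a⁻¹.u = -(D.T ^ a.k) a.u := rfl

theorem Omega_T_zpow_neg (k : ℤ) (u w : D.E) :
    D.Omega ((D.T ^ (-k)) u) w = D.Omega u ((D.T ^ k) w) := by
  rw [← D.Omega_T_zpow k, ← LinearEquiv.mul_apply, ← zpow_add]
  simp

instance : Group D.G :=
  Group.ofLeftAxioms
    (by
      intro a b c
      ext1
      · simp [add_assoc]
      · simp only [mul_q, mul_k, mul_u, map_add, D.Omega_add_left, D.Omega_add_right,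
          Omega_T_zpow_neg, zpow_add, ← LinearEquiv.mul_apply]
        simp
        ring
      · simp only [mul_u, mul_k, map_add, neg_add, add_assoc, ← LinearEquiv.mul_apply]
        rw [← zpow_add, add_comm (-c.k)])
    (by
      intro a
      ext1 <;> simp [D.Omega_zero_left])
    (by
      intro a
      ext1
      · simp
      · simp only [mul_q, inv_q, inv_u, one_q, D.Omega_neg_left, D.Omega_T_zpow, D.Omega_self]
        ring
      · simp only [mul_u, inv_u, one_u, map_neg, ← LinearEquiv.mul_apply]
        rw [← zpow_add]
        simp)

/-- The action of `G` on `ℝ² × V`: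
`(k, q, u) • (t, s, v) = (t + kp, s + q - ⟨u̇(t), 2v + u(t)⟩, v + u(t))`. -/
instance : MulAction D.G (ℝ × ℝ × V) where
  smul a x :=
    (x.1 + a.k * D.p,
      x.2.1 + a.q - D.form (deriv (a.u : ℝ → V) x.1) ((2 : ℝ) • x.2.2 + (a.u : ℝ → V) x.1),
      x.2.2 + (a.u : ℝ → V) x.1)
  one_smul := by
    rintro ⟨t, s, v⟩
    change (t + ((0 : ℤ) : ℝ) * D.p,
      s + 0 - D.form (deriv (0 : ℝ → V) t) ((2 : ℝ) • v + (0 : ℝ → V) t),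
      v + (0 : ℝ → V) t) = (t, s, v)
    have h : deriv (0 : ℝ → V) t = 0 := by simp
    rw [h]
    simp
  mul_smul := by
    rintro a b ⟨t, s, v⟩
    have hu : ((a * b).u : ℝ → V) t = (a.u : ℝ → V) (t + b.k * D.p) + (b.u : ℝ → V) t := by
      rw [mul_u, Submodule.coe_add, Pi.add_apply, D.T_zpow_apply]
      push_cast
      rw [neg_mul, sub_neg_eq_add]
    have hd : deriv ((a * b).u : ℝ → V) t
        = deriv (a.u : ℝ → V) (t + b.k * D.p) + deriv (b.u : ℝ → V) t := by
      rw [mul_u, D.deriv_add_coe, D.deriv_T_zpow_apply]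
      push_cast
      rw [neg_mul, sub_neg_eq_add]
    have hO : (a * b).q = a.q + b.q
        - (D.form (deriv (a.u : ℝ → V) (t + b.k * D.p)) ((b.u : ℝ → V) t)
          - D.form ((a.u : ℝ → V) (t + b.k * D.p)) (deriv (b.u : ℝ → V) t)) := by
      rw [mul_q, D.Omega_eq _ _ (t + b.k * D.p), D.T_zpow_apply, D.deriv_T_zpow_apply,
        add_sub_cancel_right]
    change (t + (a * b).k * D.p,
      s + (a * b).q - D.form (deriv ((a * b).u : ℝ → V) t)
        ((2 : ℝ) • v + ((a * b).u : ℝ → V) t), v + ((a * b).u : ℝ → V) t)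
      = ((t + b.k * D.p) + a.k * D.p,
        (s + b.q - D.form (deriv (b.u : ℝ → V) t) ((2 : ℝ) • v + (b.u : ℝ → V) t)) + a.q
          - D.form (deriv (a.u : ℝ → V) (t + b.k * D.p))
            ((2 : ℝ) • (v + (b.u : ℝ → V) t) + (a.u : ℝ → V) (t + b.k * D.p)),
        (v + (b.u : ℝ → V) t) + (a.u : ℝ → V) (t + b.k * D.p))
    rw [hu, hd, hO, mul_k]
    refine Prod.ext ?_ (Prod.ext ?_ ?_)
    · push_cast
      ring
    · simp only [map_add, map_smul, LinearMap.add_apply, smul_add, smul_eq_mul]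
      rw [D.form_symm ((a.u : ℝ → V) (t + b.k * D.p)) (deriv (b.u : ℝ → V) t)]
      ring
    · simp only
      abel

theorem smul_def (a : D.G) (t s : ℝ) (v : V) :
    a • ((t, s, v) : ℝ × ℝ × V) =
      (t + a.k * D.p,
        s + a.q - D.form (deriv (a.u : ℝ → V) t) ((2 : ℝ) • v + (a.u : ℝ → V) t),
        v + (a.u : ℝ → V) t) := rfl

end G

/-! ### Homomorphisms, and the objects associated with a subgroup `Γ` of `G` -/

/-- The homomorphism `Π : G → ℤ`, `Π(k, q, u) = k`. -/
def Pr : D.G →* Multiplicative ℤ where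
  toFun a := Multiplicative.ofAdd a.k
  map_one' := rfl
  map_mul' _ _ := rfl

theorem mem_ker_Pr (a : D.G) : a ∈ D.Pr.ker ↔ a.k = 0 := Iff.rfl

/-- The homomorphism `Δ : Ker Π → 𝓔`, `Δ(0, q, u) = u`. -/
def Delta : D.Pr.ker →* Multiplicative D.E where
  toFun a := Multiplicative.ofAdd (a : D.G).u
  map_one' := rfl
  map_mul' a b := by
    have hb : (b : D.G).k = 0 := b.2
    simp [hb]

/-- The homomorphism `Δ_t : Ker Π → V`, `Δ_t(0, q, u) = u(t)`. -/
def DeltaAt (t : ℝ) : D.Pr.ker →* Multiplicative V where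
  toFun a := Multiplicative.ofAdd (((a : D.G).u : ℝ → V) t)
  map_one' := rfl
  map_mul' a b := by
    have hb : (b : D.G).k = 0 := b.2
    simp [hb]

/-- `Ker Δ`, as a subgroup of `G`. -/
def kerDelta : Subgroup D.G := D.Delta.ker.map D.Pr.ker.subtype

/-- `Ker Δ_t`, as a subgroup of `G`. -/
def kerDeltaAt (t : ℝ) : Subgroup D.G := (D.DeltaAt t).ker.map D.Pr.ker.subtype

theorem mem_kerDelta (a : D.G) : a ∈ D.kerDelta ↔ a.k = 0 ∧ a.u = 0 := by
  constructor
  · rintro ⟨b, hb, rfl⟩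
    exact ⟨b.2, hb⟩
  · rintro ⟨hk, hu⟩
    exact ⟨⟨a, hk⟩, hu, rfl⟩

theorem mem_kerDeltaAt (t : ℝ) (a : D.G) :
    a ∈ D.kerDeltaAt t ↔ a.k = 0 ∧ (a.u : ℝ → V) t = 0 := by
  constructor
  · rintro ⟨b, hb, rfl⟩
    exact ⟨b.2, hb⟩
  · rintro ⟨hk, hu⟩
    exact ⟨⟨a, hk⟩, hu, rfl⟩

variable (Γ : Subgroup D.G)

/-- `Σ = Γ ∩ Ker Π`. -/
def Sig : Subgroup D.G := Γ ⊓ D.Pr.ker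

/-- `Ξ = Σ ∩ Ker Δ`. -/
def Xi : Subgroup D.G := D.Sig Γ ⊓ D.kerDelta

/-- `Λ = Δ(Σ)`, an additive subgroup of `𝓔`. -/
def Lam : AddSubgroup D.E :=
  Subgroup.toAddSubgroup' (((D.Sig Γ).subgroupOf D.Pr.ker).map D.Delta)

/-- `Δ_t(Σ)`, an additive subgroup of `V`. -/
def LamAt (t : ℝ) : AddSubgroup V :=
  Subgroup.toAddSubgroup' (((D.Sig Γ).subgroupOf D.Pr.ker).map (D.DeltaAt t))

theorem mem_Lam (w : D.E) : w ∈ D.Lam Γ ↔ ∃ a ∈ D.Sig Γ, a.u = w := by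
  constructor
  · rintro ⟨b, hb, h⟩
    exact ⟨b, hb, h⟩
  · rintro ⟨a, ha, h⟩
    exact ⟨⟨a, ha.2⟩, ha, h⟩

theorem mem_LamAt (t : ℝ) (v : V) :
    v ∈ D.LamAt Γ t ↔ ∃ a ∈ D.Sig Γ, (a.u : ℝ → V) t = v := by
  constructor
  · rintro ⟨b, hb, h⟩
    exact ⟨b, hb, h⟩
  · rintro ⟨a, ha, h⟩
    exact ⟨⟨a, ha.2⟩, ha, h⟩

/-- `𝓛 = span Λ`, a vector subspace of `𝓔`. -/
def L : Submodule ℝ D.E := Submodule.span ℝ (D.Lam Γ : Set D.E)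

/-- `Λ` as an additive subgroup of `𝓛`. -/
def LamInL : AddSubgroup (D.L Γ) := (D.Lam Γ).comap (AddSubgroupClass.subtype (D.L Γ))

/-- `Σ` treated as a subset of `ℝ × 𝓛`, through the identification of `{0} × ℝ × 𝓛 ⊂ G` with
`ℝ × 𝓛`. -/
def SigSet : Set (ℝ × D.L Γ) := {x | (⟨0, x.1, (x.2 : D.E)⟩ : D.G) ∈ D.Sig Γ}

/-- Every element of `Σ` lies in `{0} × ℝ × 𝓛`, so that nothing is lost in passing to `SigSet`. -/
theorem exists_mem_SigSet {a : D.G} (ha : a ∈ D.Sig Γ) :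
    ∃ x ∈ D.SigSet Γ, (⟨0, x.1, (x.2 : D.E)⟩ : D.G) = a := by
  have hu : a.u ∈ D.L Γ := Submodule.subset_span ((D.mem_Lam Γ a.u).2 ⟨a, ha, rfl⟩)
  have h : (⟨0, a.q, a.u⟩ : D.G) = a := G.ext (show (0 : ℤ) = a.k from ha.2.symm) rfl rfl
  refine ⟨(a.q, ⟨a.u, hu⟩), ?_, h⟩
  change (⟨0, a.q, a.u⟩ : D.G) ∈ D.Sig Γ
  rwa [h]

/-- `T^k` maps `W` into itself if `T^k(W) = W`. -/
theorem T_zpow_mem {W : Submodule ℝ D.E} {k : ℤ}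
    (h : W.map ((D.T ^ k : D.E ≃ₗ[ℝ] D.E) : D.E →ₗ[ℝ] D.E) = W) (w : W) :
    (D.T ^ k) (w : D.E) ∈ W := by
  have h' := Submodule.mem_map_of_mem
    (f := ((D.T ^ k : D.E ≃ₗ[ℝ] D.E) : D.E →ₗ[ℝ] D.E)) w.2
  rwa [h] at h'

/-- The mapping `Ψ : ℝ × 𝓛 → ℝ × 𝓛`, `Ψ(r, w) = (r - 2 Ω(u, w), T^k w)`, which makes sense when
`T^k(𝓛) = 𝓛`. -/
def Psi (k : ℤ) (u : D.E)
    (h : (D.L Γ).map ((D.T ^ k : D.E ≃ₗ[ℝ] D.E) : D.E →ₗ[ℝ] D.E) = D.L Γ)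
    (x : ℝ × D.L Γ) : ℝ × D.L Γ :=
  (x.1 - 2 * D.Omega u x.2, ⟨(D.T ^ k) (x.2 : D.E), D.T_zpow_mem h x.2⟩)

/-! ### First-order and Lagrangian subspaces, lattices, quotients -/

/-- A first-order subspace of `𝓔`: an `(n - 2)`-dimensional subspace whose nonzero elements
vanish nowhere. -/
def IsFirstOrder (W : Submodule ℝ D.E) : Prop :=
  Module.finrank ℝ W = D.n - 2 ∧ ∀ u ∈ W, u ≠ 0 → ∀ t : ℝ, (u : ℝ → V) t ≠ 0

/-- A Lagrangian subspace of `𝓔`: one on which `Ω` vanishes. -/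
def IsLagrangian (W : Submodule ℝ D.E) : Prop :=
  ∀ u ∈ W, ∀ w ∈ W, D.Omega u w = 0

/-- The action of `Γ` on `ℝ² × V` is free. -/
def ActsFreely : Prop :=
  ∀ a ∈ Γ, ∀ x : ℝ × ℝ × V, a • x = x → a = 1

/-- `π : ℝ² × V → M` is a surjective local diffeomorphism whose fibres are precisely the orbits of
`Γ`, in other words, `π` makes `M` the quotient manifold of `ℝ² × V` under `Γ`. For a free action,
the existence of such a manifold `M` and mapping `π` is what proper discontinuity means. -/
structure IsQuotientMapOf {M : Type*} [TopologicalSpace M] [ChartedSpace (ℝ × ℝ × V) M]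
    (π : ℝ × ℝ × V → M) : Prop where
  isLocalDiffeomorph : IsLocalDiffeomorph 𝓘(ℝ, ℝ × ℝ × V) 𝓘(ℝ, ℝ × ℝ × V) ∞ π
  surjective : Function.Surjective π
  fibre_eq_orbit : ∀ x y, π x = π y ↔ ∃ a ∈ Γ, a • x = y

end ConformalData

/-- A lattice in a finite-dimensional real vector space: an additive subgroup generated by some
basis. -/
def IsLatticeIn {W : Type*} [AddCommGroup W] [Module ℝ W] (S : AddSubgroup W) : Prop :=
  ∃ (d : ℕ) (b : Module.Basis (Fin d) ℝ W), S = AddSubgroup.closure (Set.range b)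

end

/-! ### Discrete subgroups and lattices -/

/-! Two facts about the action drive everything: a compact set meets only finitely many of its
translates (`ActsFreely.finite_smul_inter`), and some compact set meets every orbit
(`IsQuotientMapOf.exists_isCompact`). Since `t` moves only by multiples of `p`, cocompactness
descends to the action of `Σ` on each slice `{t} × ℝ × V` (`exists_isCompact_slice`). A functional
on `V` killing `Δ_t(Σ)` is then bounded, hence zero, so `Δ_t(Σ)` spans `V`. Freeness forbids a
nonzero `u ∈ Λ` from vanishing at `t`: there `u̇(t) ≠ 0`, and a suitable `v` makes the shift of `s`
zero (`ActsFreely.u_eq_zero`). Finiteness makes `Ξ` a discrete, hence cyclic, subgroup of `ℝ`. The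
conjugation formula `conj_eq` gives the invariance statements, the integrality of `2Ω` through
commutators, and the claim about Abelian subgroups of finite index.

The delicate point is that evaluation at `t` is injective on all of `𝓛`, not merely on `Λ`. If `θ =
0`, integrality makes `𝓛` Lagrangian, and `w(t) = 0` forces `ẇ(t)` to be orthogonal to all values at
`t`, that is, to `V`. If `θ > 0`, factoring out `Ξ` makes `Δ_t(Σ)` a lattice in `V`; lifting its
basis to `Λ` gives a linear section of evaluation, which by freeness recovers every element of `Λ`,
hence of `𝓛`. The lattice statements follow from the same finiteness and cocompactness. -/

theorem AddSubgroup.discreteTopology_of_finite_inter {W : Type*} [NormedAddCommGroup W]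
    [ProperSpace W] (S : AddSubgroup W)
    (h : ∀ K : Set W, IsCompact K → ((S : Set W) ∩ K).Finite) : DiscreteTopology S := by
  refine discreteTopology_of_isOpen_singleton_zero ?_
  have hf : (((S : Set W) ∩ Metric.closedBall 0 1) \ {0}).Finite :=
    (h _ (isCompact_closedBall 0 1)).subset Set.sdiff_subset
  have ho : IsOpen (Metric.ball (0 : W) 1 ∩ (((S : Set W) ∩ Metric.closedBall 0 1) \ {0})ᶜ) :=
    Metric.isOpen_ball.inter hf.isClosed.isOpen_compl
  convert ho.preimage (continuous_subtype_val (p := fun x => x ∈ S)) using 1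
  ext x
  simp only [Set.mem_singleton_iff, Set.mem_preimage, Set.mem_inter_iff, Set.mem_compl_iff,
    Set.mem_sdiff, not_and, not_not, SetLike.mem_coe]
  constructor
  · rintro rfl
    simp
  · rintro ⟨h1, h2⟩
    exact Subtype.ext (h2 ⟨x.2, Metric.ball_subset_closedBall h1⟩)

theorem isLatticeIn_of_finite_inter {W : Type*} [NormedAddCommGroup W] [NormedSpace ℝ W]
    [FiniteDimensional ℝ W] (S : AddSubgroup W)
    (h : ∀ K : Set W, IsCompact K → ((S : Set W) ∩ K).Finite)
    (hS : Submodule.span ℝ (S : Set W) = ⊤) : IsLatticeIn S := by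
  have : ProperSpace W := FiniteDimensional.proper ℝ W
  have hd : DiscreteTopology S := S.discreteTopology_of_finite_inter h
  let Z : Submodule ℤ W := AddSubgroup.toIntSubmodule S
  have : DiscreteTopology Z := hd
  have : IsZLattice ℝ Z := ⟨hS⟩
  have : Module.Finite ℤ Z := ZLattice.module_finite ℝ Z
  have : Module.Free ℤ Z := ZLattice.module_free ℝ Z
  let b := Module.finBasis ℤ Z
  refine ⟨_, b.ofZLatticeBasis ℝ Z, ?_⟩
  have h1 := b.ofZLatticeBasis_span ℝ (L := Z)
  apply AddSubgroup.toIntSubmodule.injective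
  rw [AddSubgroup.toIntSubmodule_closure]
  exact h1.symm

theorem IsLatticeIn.of_map {W W' : Type*} [AddCommGroup W] [Module ℝ W] [AddCommGroup W']
    [Module ℝ W'] (e : W ≃ₗ[ℝ] W') {S : AddSubgroup W} {S' : AddSubgroup W'}
    (hS : ∀ x, x ∈ S ↔ e x ∈ S') (h : IsLatticeIn S') : IsLatticeIn S := by
  obtain ⟨d, b, hb⟩ := h
  refine ⟨d, b.map e.symm, ?_⟩
  have h1 : S = S'.map (e.symm : W' →+ W) := by
    ext x
    rw [hS, AddSubgroup.mem_map]
    constructor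
    · intro h
      exact ⟨e x, h, e.symm_apply_apply x⟩
    · rintro ⟨y, hy, rfl⟩
      simpa using hy
  rw [h1, hb, AddMonoidHom.map_closure, ← Set.range_comp]
  rfl

namespace ConformalData

variable {V : Type u} [NormedAddCommGroup V] [NormedSpace ℝ V] [FiniteDimensional ℝ V]
variable (D : ConformalData V)

/-! ### Linear algebra and uniqueness for the solution space -/

theorem continuous_form {X : Type*} [TopologicalSpace X] {g h : X → V} (hg : Continuous g)
    (hh : Continuous h) : Continuous fun x => D.form (g x) (h x) := by
  have h1 : Continuous fun x => D.form.toContinuousBilinearMap (g x) (h x) :=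
    (D.form.toContinuousBilinearMap.continuous.comp hg).clm_apply hh
  simpa using h1

/-- Evaluation of solutions at `t`. -/
noncomputable def evalAt (t : ℝ) : D.E →ₗ[ℝ] V where
  toFun u := (u : ℝ → V) t
  map_add' _ _ := rfl
  map_smul' _ _ := rfl

@[simp] theorem evalAt_apply (t : ℝ) (u : D.E) : D.evalAt t u = (u : ℝ → V) t := rfl

/-- Evaluation of the derivatives of solutions at `t`. -/
noncomputable def derivAt (t : ℝ) : D.E →ₗ[ℝ] V where
  toFun u := deriv (u : ℝ → V) t
  map_add' u w := D.deriv_add_coe u w t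
  map_smul' c u := ((E.hasDerivAt u t).const_smul c).deriv

@[simp] theorem derivAt_apply (t : ℝ) (u : D.E) : D.derivAt t u = deriv (u : ℝ → V) t := rfl

theorem Omega_eq_evalAt (u w : D.E) (t : ℝ) :
    D.Omega u w = D.form (D.derivAt t u) (D.evalAt t w) - D.form (D.evalAt t u) (D.derivAt t w) :=
  D.Omega_eq u w t

theorem Omega_smul_left (c : ℝ) (u w : D.E) : D.Omega (c • u) w = c * D.Omega u w := by
  simp only [D.Omega_eq_evalAt _ _ 0, map_smul, LinearMap.smul_apply, smul_eq_mul]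
  ring

theorem Omega_smul_right (c : ℝ) (u w : D.E) : D.Omega u (c • w) = c * D.Omega u w := by
  simp only [D.Omega_eq_evalAt _ _ 0, map_smul, smul_eq_mul]
  ring

theorem Omega_swap (u w : D.E) : D.Omega u w = -D.Omega w u := by
  have h := D.Omega_self (u + w)
  rw [D.Omega_add_left, D.Omega_add_right, D.Omega_add_right, D.Omega_self, D.Omega_self] at h
  linarith

theorem form_eq_zero {v : V} (h : ∀ w, D.form v w = 0) : v = 0 :=
  D.form_nondegenerate.1 v h

/-- Periodicity bounds `f`, so the equivalent first-order linear system on `V × V` is Lipschitz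
uniformly in time and global ODE uniqueness applies. -/
theorem eq_zero_of_initial {u : D.E} {t : ℝ} (h0 : (u : ℝ → V) t = 0)
    (h1 : deriv (u : ℝ → V) t = 0) : u = 0 := by
  obtain ⟨C, hC⟩ := isBounded_iff_forall_norm_le.1
    (D.f_periodic.isBounded_of_continuous D.p_pos.ne' D.f_smooth.continuous)
  have hC : ∀ s, ‖D.f s‖ ≤ C := fun s => hC _ ⟨s, rfl⟩
  let A : V →L[ℝ] V := LinearMap.toContinuousLinearMap D.A
  let F : ℝ → V × V →L[ℝ] V × V := fun s =>
    (ContinuousLinearMap.snd ℝ V V).prod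
      (D.f s • ContinuousLinearMap.fst ℝ V V + A.comp (ContinuousLinearMap.fst ℝ V V))
  have hF : ∀ s, ‖F s‖ ≤ 1 + C + ‖A‖ := by
    intro s
    have hC0 : 0 ≤ C := (norm_nonneg _).trans (hC s)
    refine ContinuousLinearMap.opNorm_le_bound _ (by positivity) fun x => ?_
    have hx1 := norm_fst_le x
    have hx2 := norm_snd_le x
    have hx := norm_nonneg x
    have e1 : ‖D.f s • x.1‖ ≤ C * ‖x‖ := by
      rw [norm_smul]
      exact mul_le_mul (hC s) hx1 (norm_nonneg _) hC0
    have e2 : ‖A x.1‖ ≤ ‖A‖ * ‖x‖ :=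
      (A.le_opNorm x.1).trans (mul_le_mul_of_nonneg_left hx1 (norm_nonneg _))
    change ‖(x.2, D.f s • x.1 + A x.1)‖ ≤ _
    refine norm_prod_le_iff.2 ⟨?_, (norm_add_le _ _).trans ?_⟩
    · dsimp only
      nlinarith [mul_nonneg hC0 hx, mul_nonneg (norm_nonneg A) hx]
    · nlinarith
  have key := ODE_solution_unique_univ (v := fun s x => F s x) (s := fun _ => Set.univ)
    (K := Real.toNNReal (1 + C + ‖A‖)) (t₀ := t)
    (f := fun s => ((u : ℝ → V) s, deriv (u : ℝ → V) s)) (g := fun _ => 0)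
    (fun s => (((F s).lipschitz.weaken
      (NNReal.le_toNNReal_of_coe_le (hF s))).lipschitzOnWith))
    (fun s => ⟨(E.hasDerivAt u s).prodMk (E.hasDerivAt_deriv u s), Set.mem_univ _⟩)
    (fun s => ⟨by simpa using hasDerivAt_const s (0 : V × V), Set.mem_univ _⟩)
    (by simp [h0, h1])
  ext s
  exact congrArg Prod.fst (congrFun key s)

/-! ### The action -/

theorem continuous_smul_G (a : D.G) : Continuous fun x : ℝ × ℝ × V => a • x := by
  have hu : Continuous (a.u : ℝ → V) := a.u.2.1.continuous
  have hd : Continuous (deriv (a.u : ℝ → V)) := (contDiff_infty_iff_deriv.1 a.u.2.1).2.continuous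
  have h := D.continuous_form (X := ℝ × ℝ × V) (g := fun x => deriv (a.u : ℝ → V) x.1)
    (h := fun x => (2 : ℝ) • x.2.2 + (a.u : ℝ → V) x.1) (by fun_prop) (by fun_prop)
  have e : (fun x : ℝ × ℝ × V => a • x) = fun x => (x.1 + a.k * D.p,
      x.2.1 + a.q - D.form (deriv (a.u : ℝ → V) x.1) ((2 : ℝ) • x.2.2 + (a.u : ℝ → V) x.1),
      x.2.2 + (a.u : ℝ → V) x.1) := rfl
  rw [e]
  fun_prop

/-! ### Consequences of freeness, proper discontinuity and compactness of the quotient. -/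

variable {D} {Γ : Subgroup D.G}

/-- Otherwise distinct `γ_j` have, along a subsequence, `x_j → z₁` and `γ_j x_j → z₂`. As `M` is
Hausdorff, `z₂ = g z₁` for some `g ∈ Γ`. Both `g x_j` and `γ_j x_j` tend to `z₂`, near which `π` is
injective, so they eventually agree, and freeness gives `γ_j = g`. -/
theorem ActsFreely.finite_smul_inter (hfree : D.ActsFreely Γ)
    {M : Type*} [TopologicalSpace M] [T2Space M] [ChartedSpace (ℝ × ℝ × V) M]
    {π : ℝ × ℝ × V → M} (hπ : D.IsQuotientMapOf Γ π) {K : Set (ℝ × ℝ × V)} (hK : IsCompact K) :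
    {a | a ∈ Γ ∧ ∃ x ∈ K, a • x ∈ K}.Finite := by
  by_contra hinf
  have hinf : {a | a ∈ Γ ∧ ∃ x ∈ K, a • x ∈ K}.Infinite := hinf
  let γ := hinf.natEmbedding
  have hγ : ∀ j, (γ j : D.G) ∈ Γ := fun j => (γ j).2.1
  choose x hx hy using fun j => (γ j).2.2
  obtain ⟨z, hz, φ, hφ, hlim⟩ := (hK.prod hK).tendsto_subseq
    (x := fun j => (x j, (γ j : D.G) • x j)) (fun j => ⟨hx j, hy j⟩)
  have hx' := (continuous_fst.tendsto z).comp hlim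
  have hy' := (continuous_snd.tendsto z).comp hlim
  have hc : Continuous π := hπ.isLocalDiffeomorph.isLocalHomeomorph.continuous
  have hπeq : π z.1 = π z.2 := by
    refine tendsto_nhds_unique ((hc.tendsto _).comp hx') ?_
    refine ((hc.tendsto _).comp hy').congr fun j => ?_
    exact ((hπ.fibre_eq_orbit _ _).2 ⟨_, hγ _, rfl⟩).symm
  obtain ⟨g, hg, hgz⟩ := (hπ.fibre_eq_orbit _ _).1 hπeq
  obtain ⟨e, hze, he⟩ := hπ.isLocalDiffeomorph.isLocalHomeomorph z.2
  have hgx := ((D.continuous_smul_G g).tendsto z.1).comp hx'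
  rw [hgz] at hgx
  have hev := (hgx.eventually (e.open_source.mem_nhds hze)).and
    (hy'.eventually (e.open_source.mem_nhds hze))
  have hev2 : ∀ᶠ j in Filter.atTop, (γ (φ j) : D.G) = g := by
    filter_upwards [hev] with j hj
    have h1 : π (g • x (φ j)) = π ((γ (φ j) : D.G) • x (φ j)) :=
      ((hπ.fibre_eq_orbit _ _).2 ⟨_, hg, rfl⟩).symm.trans
        ((hπ.fibre_eq_orbit _ _).2 ⟨_, hγ _, rfl⟩)
    rw [he] at h1
    have h2 : g • x (φ j) = (γ (φ j) : D.G) • x (φ j) := e.injOn hj.1 hj.2 h1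
    have h3 := hfree _ (Γ.mul_mem (Γ.inv_mem hg) (hγ (φ j))) (x (φ j))
      (by rw [mul_smul, ← h2, inv_smul_smul])
    exact (inv_mul_eq_one.1 h3).symm
  obtain ⟨N, hN⟩ := Filter.eventually_atTop.1 hev2
  have h1 : γ (φ N) = γ (φ (N + 1)) := Subtype.ext ((hN N le_rfl).trans (hN (N + 1) (by simp)).symm)
  have h2 := hφ (Nat.lt_succ_self N)
  have h3 : φ N = φ (N + 1) := γ.injective h1
  exact h2.ne h3

/-- The open map `π` sends balls about the origin to an open cover of the compact `M`. -/
theorem IsQuotientMapOf.exists_isCompact {M : Type*} [TopologicalSpace M] [CompactSpace M]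
    [ChartedSpace (ℝ × ℝ × V) M] {π : ℝ × ℝ × V → M} (hπ : D.IsQuotientMapOf Γ π) :
    ∃ K : Set (ℝ × ℝ × V), IsCompact K ∧ ∀ x, ∃ a ∈ Γ, a • x ∈ K := by
  have : ProperSpace V := FiniteDimensional.proper ℝ V
  have ho : IsOpenMap π := hπ.isLocalDiffeomorph.isOpenMap
  obtain ⟨F, hF⟩ := isCompact_univ.elim_finite_subcover
    (fun j : ℕ => π '' Metric.ball 0 j) (fun j => ho _ Metric.isOpen_ball) (by
      intro m _
      obtain ⟨x, rfl⟩ := hπ.surjective m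
      obtain ⟨j, hj⟩ := exists_nat_gt ‖x‖
      exact Set.mem_iUnion.2 ⟨j, x, by simpa using hj, rfl⟩)
  refine ⟨⋃ j ∈ F, Metric.closedBall 0 j,
    F.isCompact_biUnion fun j _ => isCompact_closedBall _ _, fun x => ?_⟩
  obtain ⟨j, hj, y, hy, hyx⟩ := Set.mem_iUnion₂.1 (hF (Set.mem_univ (π x)))
  obtain ⟨a, ha, rfl⟩ := (hπ.fibre_eq_orbit x y).1 hyx.symm
  exact ⟨a, ha, Set.mem_iUnion₂.2 ⟨j, hj, Metric.ball_subset_closedBall hy⟩⟩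

theorem exists_mem_one_le_k
    (hC : ∃ K : Set (ℝ × ℝ × V), IsCompact K ∧ ∀ x, ∃ a ∈ Γ, a • x ∈ K) :
    ∃ a ∈ Γ, 1 ≤ a.k := by
  obtain ⟨K, hK, h⟩ := hC
  obtain ⟨C, hC⟩ := isBounded_iff_forall_norm_le.1 hK.isBounded
  -- A point with `t = C + 1` lies outside `K`, so bringing it into `K` must change `t`, whence `k ≠
  -- 0`.
  obtain ⟨a, ha, hx⟩ := h (C + 1, 0, 0)
  have h1 := (norm_fst_le _).trans (hC _ hx)
  rw [G.smul_def, Real.norm_eq_abs] at h1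
  have h2 : a.k ≠ 0 := by
    intro h0
    rw [h0] at h1
    have := le_abs_self (C + 1 + ((0 : ℤ) : ℝ) * D.p)
    push_cast at h1 this
    linarith
  rcases lt_or_gt_of_ne h2 with h3 | h3
  · exact ⟨a⁻¹, Γ.inv_mem ha, by rw [G.inv_k]; omega⟩
  · exact ⟨a, ha, h3⟩

theorem mem_Sig {a : D.G} : a ∈ D.Sig Γ ↔ a ∈ Γ ∧ a.k = 0 := Iff.rfl

theorem smul_of_mem_Sig {a : D.G} (ha : a ∈ D.Sig Γ) (t s : ℝ) (v : V) :
    a • ((t, s, v) : ℝ × ℝ × V) = (t,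
      s + a.q - D.form (deriv (a.u : ℝ → V) t) ((2 : ℝ) • v + (a.u : ℝ → V) t),
      v + (a.u : ℝ → V) t) := by
  rw [G.smul_def, (mem_Sig.1 ha).2]
  simp

/-- An element taking a point of the slice into `K` has one of finitely many values of `k`. Undoing
it by a fixed representative of that `k` leaves an element of `Σ` and enlarges `K` only to a finite
union of translates. -/
theorem exists_isCompact_slice
    (hC : ∃ K : Set (ℝ × ℝ × V), IsCompact K ∧ ∀ x, ∃ a ∈ Γ, a • x ∈ K) (t : ℝ) :
    ∃ C : ℝ, ∀ (s : ℝ) (v : V), ∃ a ∈ D.Sig Γ,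
      |s + a.q - D.form (deriv (a.u : ℝ → V) t) ((2 : ℝ) • v + (a.u : ℝ → V) t)| ≤ C ∧
      ‖v + (a.u : ℝ → V) t‖ ≤ C := by
  classical
  obtain ⟨K, hK, h⟩ := hC
  obtain ⟨C, hC⟩ := isBounded_iff_forall_norm_le.1 hK.isBounded
  have hFfin : {k : ℤ | |t + k * D.p| ≤ C}.Finite := by
    refine (Set.finite_Icc ⌊(-C - t) / D.p⌋ ⌈(C - t) / D.p⌉).subset fun k hk => ?_
    obtain ⟨h1, h2⟩ := abs_le.1 (show |t + k * D.p| ≤ C from hk)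
    constructor
    · have h3 : (-C - t) / D.p ≤ k := by
        rw [div_le_iff₀ D.p_pos]
        linarith
      exact_mod_cast (Int.floor_le _).trans h3
    · have h3 : (k : ℝ) ≤ (C - t) / D.p := by
        rw [le_div_iff₀ D.p_pos]
        linarith
      exact_mod_cast h3.trans (Int.le_ceil _)
  -- The default `1` is harmless: at other values of `k` it only enlarges the compact union below.
  let g : ℤ → D.G := fun k => if hk : ∃ a ∈ Γ, a.k = k then hk.choose else 1
  have hg : ∀ a ∈ Γ, g a.k ∈ Γ ∧ (g a.k).k = a.k := by
    intro a ha
    have hk : ∃ b ∈ Γ, b.k = a.k := ⟨a, ha, rfl⟩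
    simp only [g, dif_pos hk]
    exact hk.choose_spec
  have hK1 : IsCompact (⋃ k ∈ {k : ℤ | |t + k * D.p| ≤ C}, (fun x => (g k)⁻¹ • x) '' K) :=
    hFfin.isCompact_biUnion fun k _ => hK.image (D.continuous_smul_G _)
  obtain ⟨C', hC'⟩ := isBounded_iff_forall_norm_le.1 hK1.isBounded
  refine ⟨C', fun s v => ?_⟩
  obtain ⟨a, ha, hx⟩ := h (t, s, v)
  obtain ⟨h1, h2⟩ := hg a ha
  have hσ : (g a.k)⁻¹ * a ∈ D.Sig Γ := by
    refine mem_Sig.2 ⟨Γ.mul_mem (Γ.inv_mem h1) ha, ?_⟩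
    rw [G.mul_k, G.inv_k, h2]
    ring
  have hk : |t + a.k * D.p| ≤ C := by
    have := (norm_fst_le _).trans (hC _ hx)
    rwa [G.smul_def] at this
  have hb := hC' (((g a.k)⁻¹ * a) • (t, s, v)) (Set.mem_iUnion₂.2 ⟨a.k, hk, a • (t, s, v), hx,
    (mul_smul _ _ _).symm⟩)
  rw [smul_of_mem_Sig hσ] at hb
  have hb2 := (norm_snd_le _).trans hb
  exact ⟨_, hσ, (norm_fst_le _).trans hb2, (norm_snd_le _).trans hb2⟩

theorem finite_Sig_of_isCompact
    (hP : ∀ K : Set (ℝ × ℝ × V), IsCompact K → {a | a ∈ Γ ∧ ∃ x ∈ K, a • x ∈ K}.Finite)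
    (t : ℝ) {K : Set (ℝ × V)} (hK : IsCompact K) :
    {a | a ∈ D.Sig Γ ∧
      (a.q - D.form (deriv (a.u : ℝ → V) t) ((a.u : ℝ → V) t), (a.u : ℝ → V) t) ∈ K}.Finite := by
  -- The pair in question is the image of the slice's origin `(t, 0, 0)`, so the origin is adjoined
  -- to `K`.
  refine (hP ({t} ×ˢ (insert 0 K)) (isCompact_singleton.prod (hK.insert 0))).subset ?_
  rintro a ⟨ha, hb⟩
  refine ⟨ha.1, (t, 0, 0), ⟨rfl, Set.mem_insert _ _⟩, ?_⟩
  rw [smul_of_mem_Sig ha]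
  refine ⟨rfl, Set.mem_insert_of_mem _ ?_⟩
  simpa using hb

/-! ### The subgroup `Σ` -/

/-- A functional killing `Δ_t(Σ)` is unchanged when `Σ` moves `v` into a fixed ball; so it is
bounded, hence zero. -/
theorem span_LamAt
    (hC : ∃ K : Set (ℝ × ℝ × V), IsCompact K ∧ ∀ x, ∃ a ∈ Γ, a • x ∈ K) (t : ℝ) :
    Submodule.span ℝ (D.LamAt Γ t : Set V) = ⊤ := by
  by_contra hne
  obtain ⟨l, hl, hle⟩ := Submodule.exists_le_ker_of_lt_top _ (lt_top_iff_ne_top.2 hne)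
  refine hl ?_
  obtain ⟨C, hC⟩ := exists_isCompact_slice hC t
  let l' : V →L[ℝ] ℝ := LinearMap.toContinuousLinearMap l
  have hbd : ∀ v, |l v| ≤ ‖l'‖ * C := by
    intro v
    obtain ⟨a, ha, -, h2⟩ := hC 0 v
    have h0 : l ((a.u : ℝ → V) t) = 0 :=
      hle (Submodule.subset_span ((D.mem_LamAt Γ t _).2 ⟨a, ha, rfl⟩))
    have h3 : l v = l' (v + (a.u : ℝ → V) t) := by
      change l v = l (v + (a.u : ℝ → V) t)
      rw [map_add, h0, add_zero]
    rw [h3]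
    exact (l'.le_opNorm _).trans (mul_le_mul_of_nonneg_left h2 (norm_nonneg _))
  ext v
  by_contra hv
  have hv : l v ≠ 0 := hv
  have h4 := hbd (((‖l'‖ * C + 1) / l v) • v)
  rw [map_smul, smul_eq_mul, div_mul_cancel₀ _ hv] at h4
  linarith [le_abs_self (‖l'‖ * C + 1)]

theorem ActsFreely.u_eq_zero (hfree : D.ActsFreely Γ) {a : D.G} (ha : a ∈ D.Sig Γ) {t : ℝ}
    (ht : (a.u : ℝ → V) t = 0) : a.u = 0 := by
  by_contra hne
  have h1 : deriv (a.u : ℝ → V) t ≠ 0 := fun h => hne (D.eq_zero_of_initial ht h)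
  obtain ⟨w, hw⟩ : ∃ w, D.form (deriv (a.u : ℝ → V) t) w ≠ 0 := by
    by_contra! h
    exact h1 (D.form_eq_zero h)
  -- The multiple of `w` solves `q = 2⟨u̇(t), v⟩`, making the point fixed.
  have h2 := hfree a ha.1 (t, 0, (a.q / (2 * D.form (deriv (a.u : ℝ → V) t) w)) • w) (by
    rw [smul_of_mem_Sig ha, ht]
    simp only [add_zero, map_smul, smul_eq_mul]
    congr 2
    field_simp
    ring)
  exact hne (by rw [h2]; rfl)

theorem ActsFreely.Sig_inf_kerDeltaAt (hfree : D.ActsFreely Γ) (t : ℝ) :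
    D.Sig Γ ⊓ D.kerDeltaAt t = D.Xi Γ := by
  ext a
  simp only [Xi, Subgroup.mem_inf, mem_kerDelta, mem_kerDeltaAt]
  constructor
  · rintro ⟨h1, h2, h3⟩
    exact ⟨h1, h2, hfree.u_eq_zero h1 h3⟩
  · rintro ⟨h1, h2, h3⟩
    exact ⟨h1, h2, by rw [h3]; rfl⟩

theorem mem_Xi {a : D.G} : a ∈ D.Xi Γ ↔ a ∈ Γ ∧ a.k = 0 ∧ a.u = 0 := by
  simp only [Xi, Subgroup.mem_inf, mem_kerDelta, mem_Sig]
  tauto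

theorem exists_Xi_eq
    (hP : ∀ K : Set (ℝ × ℝ × V), IsCompact K → {a | a ∈ Γ ∧ ∃ x ∈ K, a • x ∈ K}.Finite) :
    ∃ θ : ℝ, 0 ≤ θ ∧ (D.Xi Γ : Set D.G) = {a | ∃ l : ℤ, a = ⟨0, l * θ, 0⟩} := by
  let S : AddSubgroup ℝ :=
    { carrier := {q | (⟨0, q, 0⟩ : D.G) ∈ Γ}
      zero_mem' := Γ.one_mem
      add_mem' := fun {q r} hq hr => by
        have h := Γ.mul_mem hq hr
        have e : (⟨0, q, 0⟩ * ⟨0, r, 0⟩ : D.G) = ⟨0, q + r, 0⟩ := by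
          ext1 <;> simp [D.Omega_zero_left]
        rwa [e] at h
      neg_mem' := fun {q} hq => by
        have h := Γ.inv_mem hq
        have e : (⟨0, q, 0⟩ : D.G)⁻¹ = ⟨0, -q, 0⟩ := by
          ext1 <;> simp
        rwa [e] at h }
  have hS : ∀ q, q ∈ S ↔ (⟨0, q, 0⟩ : D.G) ∈ Γ := fun _ => Iff.rfl
  have hfin : ∀ K : Set ℝ, IsCompact K → ((S : Set ℝ) ∩ K).Finite := by
    intro K hK
    have hf := finite_Sig_of_isCompact hP 0 (hK.prod (isCompact_singleton (x := (0 : V))))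
    refine (hf.image G.q).subset ?_
    rintro q ⟨hq, hqK⟩
    refine ⟨⟨0, q, 0⟩, ⟨⟨hq, rfl⟩, ?_⟩, rfl⟩
    refine ⟨?_, rfl⟩
    simpa using hqK
  obtain ⟨c, hc⟩ : ∃ c : ℝ, S = AddSubgroup.closure {c} := by
    -- A dense discrete subgroup would be closed, hence all of `ℝ`, and would meet `[0, 1]` in an
    -- infinite set.
    rcases S.dense_or_cyclic with h | h
    · have hd : DiscreteTopology S := S.discreteTopology_of_finite_inter hfin
      have hcl : IsClosed (S : Set ℝ) := AddSubgroup.isClosed_of_discrete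
      have h1 := hfin _ (isCompact_Icc (a := 0) (b := 1))
      rw [← hcl.closure_eq, h.closure_eq, Set.univ_inter] at h1
      exact (Set.Icc_infinite zero_lt_one h1).elim
    · exact h
  refine ⟨|c|, abs_nonneg c, ?_⟩
  have hmem : ∀ q, q ∈ S ↔ ∃ l : ℤ, q = l * |c| := by
    intro q
    rw [hc, AddSubgroup.mem_closure_singleton]
    rcases abs_choice c with h | h <;> rw [h]
    · simp [eq_comm]
    · constructor
      · rintro ⟨l, rfl⟩
        exact ⟨-l, by simp⟩
      · rintro ⟨l, rfl⟩
        exact ⟨-l, by simp⟩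
  ext a
  simp only [SetLike.mem_coe, mem_Xi, Set.mem_ofPred_eq]
  constructor
  · rintro ⟨h1, h2, h3⟩
    have e : a = ⟨0, a.q, 0⟩ := G.ext h2 rfl h3
    rw [e, ← hS, hmem] at h1
    obtain ⟨l, hl⟩ := h1
    exact ⟨l, by rw [← hl]; exact e⟩
  · rintro ⟨l, rfl⟩
    exact ⟨(hS _).1 ((hmem _).2 ⟨l, rfl⟩), rfl, rfl⟩

/-! ### Conjugation and commutators. -/

theorem conj_eq (k : ℤ) (q r : ℝ) (u w : D.E) :
    (⟨k, q, u⟩ * ⟨0, r, w⟩ * (⟨k, q, u⟩ : D.G)⁻¹ : D.G)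
      = ⟨0, r - 2 * D.Omega u w, (D.T ^ k) w⟩ := by
  ext1
  · simp
  · have h1 : D.Omega (u + w) ((D.T ^ (-k)) (-(D.T ^ k) u)) = -D.Omega (u + w) u := by
      rw [map_neg, ← LinearEquiv.mul_apply, ← zpow_add, neg_add_cancel, zpow_zero,
        LinearEquiv.coe_one, id, D.Omega_swap _ (-u), D.Omega_neg_left, neg_neg,
        D.Omega_swap u]
    have hs := D.Omega_swap w u
    simp only [G.mul_q, G.inv_u, G.inv_k, G.inv_q, G.mul_u, neg_zero, zpow_zero,
      LinearEquiv.coe_one, id, h1, D.Omega_add_left, D.Omega_self]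
    linarith
  · simp

theorem conj_mem_Sig {g a : D.G} (hg : g ∈ Γ) (ha : a ∈ D.Sig Γ) :
    (⟨0, a.q - 2 * D.Omega g.u a.u, (D.T ^ g.k) a.u⟩ : D.G) ∈ D.Sig Γ := by
  refine mem_Sig.2 ⟨?_, rfl⟩
  rw [← conj_eq g.k g.q]
  have e : (⟨0, a.q, a.u⟩ : D.G) = a := G.ext (mem_Sig.1 ha).2.symm rfl rfl
  rw [e]
  exact Γ.mul_mem (Γ.mul_mem hg ha.1) (Γ.inv_mem hg)

/-- The element is the commutator `b a b⁻¹ a⁻¹`, computed by the conjugation formula with `k = 0`.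
-/
theorem commutator_mem_Xi {a b : D.G} (ha : a ∈ D.Sig Γ) (hb : b ∈ D.Sig Γ) :
    (⟨0, 2 * D.Omega a.u b.u, 0⟩ : D.G) ∈ D.Xi Γ := by
  refine mem_Xi.2 ⟨?_, rfl, rfl⟩
  have h := Γ.mul_mem (conj_mem_Sig hb.1 ha).1 (Γ.inv_mem ha.1)
  have hs := D.Omega_swap b.u a.u
  have h1 : D.Omega a.u (-a.u) = 0 := by
    rw [D.Omega_swap, D.Omega_neg_left, D.Omega_self]
    simp
  convert h using 1
  ext1
  · simp [(mem_Sig.1 ha).2]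
  · simp only [G.mul_q, G.inv_k, G.inv_q, G.inv_u, (mem_Sig.1 ha).2, (mem_Sig.1 hb).2, neg_zero,
      zpow_zero, LinearEquiv.coe_one, id, h1]
    linarith
  · simp [(mem_Sig.1 ha).2, (mem_Sig.1 hb).2]

/-! ### Invariance under `T ^ k` -/

theorem T_zpow_mem_Lam {g : D.G} (hg : g ∈ Γ) {w : D.E} (hw : w ∈ D.Lam Γ) :
    (D.T ^ g.k) w ∈ D.Lam Γ := by
  obtain ⟨a, ha, rfl⟩ := (D.mem_Lam Γ w).1 hw
  exact (D.mem_Lam Γ _).2 ⟨_, conj_mem_Sig hg ha, rfl⟩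

theorem T_zpow_image_Lam {g : D.G} (hg : g ∈ Γ) :
    (D.T ^ g.k) '' (D.Lam Γ : Set D.E) = D.Lam Γ := by
  refine Set.Subset.antisymm ?_ fun w hw => ?_
  · rintro _ ⟨w, hw, rfl⟩
    exact T_zpow_mem_Lam hg hw
  · refine ⟨_, T_zpow_mem_Lam (Γ.inv_mem hg) hw, ?_⟩
    rw [G.inv_k, ← LinearEquiv.mul_apply, ← zpow_add]
    simp

theorem map_T_zpow_L {g : D.G} (hg : g ∈ Γ) :
    (D.L Γ).map ((D.T ^ g.k : D.E ≃ₗ[ℝ] D.E) : D.E →ₗ[ℝ] D.E) = D.L Γ := by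
  rw [L, Submodule.map_span]
  exact congrArg _ (T_zpow_image_Lam hg)

theorem Psi_image_SigSet {g : D.G} (hg : g ∈ Γ)
    (h : (D.L Γ).map ((D.T ^ g.k : D.E ≃ₗ[ℝ] D.E) : D.E →ₗ[ℝ] D.E) = D.L Γ) :
    D.Psi Γ g.k g.u h '' D.SigSet Γ = D.SigSet Γ := by
  refine Set.Subset.antisymm ?_ fun y hy => ?_
  · rintro _ ⟨x, hx, rfl⟩
    exact conj_mem_Sig hg hx
  -- Conjugation by `g⁻¹` supplies the preimage of `y`; the `Ω` terms cancel since `T` preserves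
  -- `Ω`.
  · have h1 := conj_mem_Sig (Γ.inv_mem hg) hy
    obtain ⟨x, hx, hxe⟩ := exists_mem_SigSet _ _ h1
    refine ⟨x, hx, ?_⟩
    have hq := congrArg G.q hxe
    have hu := congrArg G.u hxe
    simp only [G.inv_u, G.inv_k, D.Omega_neg_left] at hq hu
    have hT : (D.T ^ g.k) (x.2 : D.E) = y.2 := by
      rw [hu, ← LinearEquiv.mul_apply, ← zpow_add]
      simp
    refine Prod.ext ?_ (Subtype.ext hT)
    change x.1 - 2 * D.Omega g.u x.2 = y.1
    have h2 := D.Omega_T_zpow g.k g.u x.2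
    rw [hT] at h2
    rw [hq, ← h2]
    ring

/-! ### Powers and Abelian subgroups of finite index. -/

theorem pow_u {a : D.G} (ha : a.k = 0) (j : ℕ) : (a ^ j).u = j • a.u := by
  induction j with
  | zero => simp
  | succ j ih => rw [pow_succ, G.mul_u, ih, ha, succ_nsmul]; simp

theorem pow_k (a : D.G) (j : ℕ) : (a ^ j).k = j * a.k := by
  induction j with
  | zero => simp
  | succ j ih =>
    rw [pow_succ, G.mul_k, ih]
    push_cast
    ring

theorem T_zpow_eq_of_commute {g a : D.G} (hg : g * a = a * g) (ha : a.k = 0) :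
    (D.T ^ g.k) a.u = a.u := by
  have e : (⟨0, a.q, a.u⟩ : D.G) = a := G.ext ha.symm rfl rfl
  have h := conj_eq g.k g.q a.q g.u a.u
  rw [e] at h
  change g * a * g⁻¹ = _ at h
  rw [hg, mul_inv_cancel_right] at h
  exact (congrArg G.u h).symm

/-- Some power of `g`, and some power `a ^ m` of each `a ∈ Σ`, lie in `H` and commute, so the
resulting power of `T` fixes `m • a.u`. The power of `g` does not depend on `a`, and `m` can be
divided out over `ℝ`. -/
theorem exists_T_zpow_eq_id (hk : ∃ a ∈ Γ, 1 ≤ a.k) (H : Subgroup Γ) [hc : IsMulCommutative H]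
    [H.FiniteIndex] :
    ∃ g ∈ Γ, 1 ≤ g.k ∧ ∀ w ∈ D.L Γ, (D.T ^ g.k) w = w := by
  obtain ⟨g, hg, hgk⟩ := hk
  obtain ⟨n, hn, -, hgn⟩ :=
    H.exists_pow_mem_of_index_ne_zero Subgroup.FiniteIndex.index_ne_zero ⟨g, hg⟩
  refine ⟨g ^ n, Γ.pow_mem hg n, ?_, fun w hw => ?_⟩
  · rw [pow_k]
    have : (1 : ℤ) ≤ n := by exact_mod_cast hn
    nlinarith
  have hle : D.L Γ ≤ LinearMap.eqLocus ((D.T ^ (g ^ n).k : D.E ≃ₗ[ℝ] D.E) : D.E →ₗ[ℝ] D.E)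
      LinearMap.id := by
    refine Submodule.span_le.2 fun x hx => ?_
    obtain ⟨a, ha, rfl⟩ := (D.mem_Lam Γ x).1 hx
    have hak := (mem_Sig.1 ha).2
    obtain ⟨m, hm, -, ham⟩ :=
      H.exists_pow_mem_of_index_ne_zero Subgroup.FiniteIndex.index_ne_zero ⟨a, ha.1⟩
    have hcomm : g ^ n * a ^ m = a ^ m * g ^ n := by
      have h := hc.is_comm.comm ⟨_, hgn⟩ ⟨_, ham⟩
      exact congrArg (fun x : H => ((x : Γ) : D.G)) h
    have h := T_zpow_eq_of_commute hcomm (by rw [pow_k, hak, mul_zero])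
    rw [pow_u hak, map_nsmul] at h
    rw [← Nat.cast_smul_eq_nsmul ℝ, ← Nat.cast_smul_eq_nsmul ℝ] at h
    exact smul_right_injective D.E (Nat.cast_ne_zero.2 hm.ne' : (m : ℝ) ≠ 0) h
  exact hle hw

/-! ### The span of `Λ` -/

theorem exists_mem_L_apply_eq {t : ℝ} (hs : Submodule.span ℝ (D.LamAt Γ t : Set V) = ⊤) (v : V) :
    ∃ w ∈ D.L Γ, (w : ℝ → V) t = v := by
  have h : Submodule.span ℝ (D.LamAt Γ t : Set V) ≤ (D.L Γ).map (D.evalAt t) := by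
    refine Submodule.span_le.2 fun x hx => ?_
    obtain ⟨a, ha, rfl⟩ := (D.mem_LamAt Γ t x).1 hx
    exact ⟨a.u, Submodule.subset_span ((D.mem_Lam Γ _).2 ⟨a, ha, rfl⟩), rfl⟩
  rw [hs] at h
  exact h (Submodule.mem_top (x := v))

theorem exists_evalEquiv {W : Submodule ℝ D.E} {t : ℝ}
    (hinj : ∀ w ∈ W, (w : ℝ → V) t = 0 → w = 0) (hsurj : ∀ v, ∃ w ∈ W, (w : ℝ → V) t = v) :
    ∃ e : W ≃ₗ[ℝ] V, ∀ w : W, e w = ((w : D.E) : ℝ → V) t := by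
  refine ⟨LinearEquiv.ofBijective ((D.evalAt t).domRestrict W) ⟨?_, fun v => ?_⟩, fun w => rfl⟩
  · exact (injective_iff_map_eq_zero _).2 fun w hw => Subtype.ext (hinj w w.2 hw)
  · obtain ⟨w, hw, h⟩ := hsurj v
    exact ⟨⟨w, hw⟩, h⟩

theorem isFirstOrder_of_evalEquiv {W : Submodule ℝ D.E}
    (hinj : ∀ t, ∀ w ∈ W, (w : ℝ → V) t = 0 → w = 0)
    (hsurj : ∀ v, ∃ w ∈ W, (w : ℝ → V) 0 = v) : D.IsFirstOrder W := by
  obtain ⟨e, -⟩ := exists_evalEquiv (hinj 0) hsurj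
  exact ⟨by rw [e.finrank_eq, D.finrank_V], fun w hw hne t h => hne (hinj t w hw h)⟩

/-- When `w(t) = 0`, `Ω(w, x)` reduces to `⟨ẇ(t), x(t)⟩`; as the values `x(t)` fill `V`,
nondegeneracy gives `ẇ(t) = 0`. -/
theorem IsLagrangian.eq_zero_of_apply_eq_zero {W : Submodule ℝ D.E} (hW : D.IsLagrangian W)
    {t : ℝ} (hsurj : ∀ v, ∃ w ∈ W, (w : ℝ → V) t = v) {w : D.E} (hw : w ∈ W)
    (h : (w : ℝ → V) t = 0) : w = 0 := by
  refine D.eq_zero_of_initial h (D.form_eq_zero fun v => ?_)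
  obtain ⟨x, hx, rfl⟩ := hsurj v
  have h1 := hW w hw x hx
  rw [D.Omega_eq _ _ t, h] at h1
  simpa using h1

theorem isLagrangian_L (h : ∀ u ∈ D.Lam Γ, ∀ w ∈ D.Lam Γ, D.Omega u w = 0) :
    D.IsLagrangian (D.L Γ) := by
  intro u hu w hw
  refine Submodule.span_induction₂ (p := fun x y _ _ => D.Omega x y = 0)
    (fun x y hx hy => h x hx y hy) (fun _ _ => D.Omega_zero_left _)
    (fun _ _ => D.Omega_zero_right _) ?_ ?_ ?_ ?_ hu hw
  · intro x y z _ _ _ h1 h2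
    rw [D.Omega_add_left, h1, h2, add_zero]
  · intro x y z _ _ _ h1 h2
    rw [D.Omega_add_right, h1, h2, add_zero]
  · intro r x y _ _ h1
    rw [D.Omega_smul_left, h1, mul_zero]
  · intro r x y _ _ h1
    rw [D.Omega_smul_right, h1, mul_zero]

/-! ### The case of trivial `Ξ` -/

/-- `Σ` as an additive subgroup of `ℝ × 𝓛` when `𝓛` is Lagrangian. -/
def IsLagrangian.sigAddSubgroup (hL : D.IsLagrangian (D.L Γ)) : AddSubgroup (ℝ × D.L Γ) where
  carrier := D.SigSet Γ
  zero_mem' := (D.Sig Γ).one_mem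
  add_mem' := fun {x y} hx hy => by
    have h := (D.Sig Γ).mul_mem hx hy
    -- The `Ω` term of the product vanishes on a Lagrangian `𝓛`, so the group law is plain addition.
    have e : (⟨0, x.1, x.2⟩ * ⟨0, y.1, y.2⟩ : D.G) = ⟨0, (x + y).1, (x + y).2⟩ := by
      ext1 <;> simp [hL _ x.2.2 _ y.2.2]
    rwa [e] at h
  neg_mem' := fun {x} hx => by
    have h := (D.Sig Γ).inv_mem hx
    have e : (⟨0, x.1, x.2⟩ : D.G)⁻¹ = ⟨0, (-x).1, (-x).2⟩ := by
      ext1 <;> simp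
    rwa [e] at h

theorem IsLagrangian.exists_addEquiv (hL : D.IsLagrangian (D.L Γ)) (hXi : D.Xi Γ = ⊥) :
    ∃ e : hL.sigAddSubgroup ≃+ D.Lam Γ, ∀ x, (e x : D.E) = (x : ℝ × D.L Γ).2 := by
  let F : hL.sigAddSubgroup →+ D.Lam Γ :=
    { toFun := fun x => ⟨((x : ℝ × D.L Γ).2 : D.E), (D.mem_Lam Γ _).2 ⟨_, x.2, rfl⟩⟩
      map_zero' := rfl
      map_add' := fun _ _ => rfl }
  refine ⟨AddEquiv.ofBijective F ⟨?_, ?_⟩, fun x => rfl⟩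
  · refine (injective_iff_map_eq_zero F).2 fun x hx => ?_
    have hx2 : ((x : ℝ × D.L Γ).2 : D.E) = 0 := congrArg Subtype.val hx
    have h1 : (⟨0, (x : ℝ × D.L Γ).1, ((x : ℝ × D.L Γ).2 : D.E)⟩ : D.G) ∈ D.Xi Γ :=
      mem_Xi.2 ⟨x.2.1, rfl, hx2⟩
    rw [hXi, Subgroup.mem_bot] at h1
    exact Subtype.ext (Prod.ext (congrArg G.q h1) (Subtype.ext hx2))
  · rintro ⟨w, hw⟩
    obtain ⟨a, ha, rfl⟩ := (D.mem_Lam Γ w).1 hw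
    obtain ⟨x, hx, hxe⟩ := exists_mem_SigSet _ _ ha
    exact ⟨⟨x, hx⟩, Subtype.ext (congrArg G.u hxe)⟩

/-- A functional killing `S` is bounded on `ℝ × {0}`, hence zero there; it then factors through `V`,
where it kills a spanning set. -/
theorem span_eq_top_of_slice {S : Set (ℝ × V)}
    (hspan : Submodule.span ℝ (Prod.snd '' S) = ⊤) {C : ℝ}
    (hC : ∀ s : ℝ, ∃ x ∈ S, |s + x.1| ≤ C ∧ ‖x.2‖ ≤ C) : Submodule.span ℝ S = ⊤ := by
  by_contra hne
  obtain ⟨l, hl, hle⟩ := Submodule.exists_le_ker_of_lt_top _ (lt_top_iff_ne_top.2 hne)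
  refine hl ?_
  have hlS : ∀ x ∈ S, l x = 0 := fun x hx => hle (Submodule.subset_span hx)
  let l' : ℝ × V →L[ℝ] ℝ := LinearMap.toContinuousLinearMap l
  have hbd : ∀ s : ℝ, |l (s, 0)| ≤ ‖l'‖ * C := by
    intro s
    obtain ⟨x, hx, h1, h2⟩ := hC s
    have h3 : l (s, 0) = l' (s + x.1, x.2) := by
      change l (s, 0) = l (s + x.1, x.2)
      have e : ((s + x.1, x.2) : ℝ × V) = (s, 0) + x := by
        ext <;> simp
      rw [e, map_add, hlS x hx, add_zero]
    rw [h3]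
    exact (l'.le_opNorm _).trans
      (mul_le_mul_of_nonneg_left (norm_prod_le_iff.2 ⟨h1, h2⟩) (norm_nonneg _))
  have h0 : l (1, 0) = 0 := by
    by_contra hv
    have h4 := hbd ((‖l'‖ * C + 1) / l (1, 0))
    have e : (((‖l'‖ * C + 1) / l (1, 0), 0) : ℝ × V)
        = ((‖l'‖ * C + 1) / l (1, 0)) • ((1, 0) : ℝ × V) := by
      ext <;> simp
    rw [e, map_smul, smul_eq_mul, div_mul_cancel₀ _ hv] at h4
    linarith [le_abs_self (‖l'‖ * C + 1)]
  have h1 : ∀ s : ℝ, l (s, 0) = 0 := by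
    intro s
    have e : ((s, 0) : ℝ × V) = s • ((1, 0) : ℝ × V) := by
      ext <;> simp
    rw [e, map_smul, h0, smul_zero]
  have h2 : ∀ v, l (0, v) = 0 := by
    have : Submodule.span ℝ (Prod.snd '' S) ≤ LinearMap.ker (l ∘ₗ LinearMap.inr ℝ ℝ V) := by
      refine Submodule.span_le.2 ?_
      rintro _ ⟨x, hx, rfl⟩
      change l (0, x.2) = 0
      have h3 := hlS x hx
      have e : x = (x.1, 0) + (0, x.2) := by
        ext <;> simp
      rwa [e, map_add, h1, zero_add] at h3
    rw [hspan] at this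
    exact fun v => this (Submodule.mem_top (x := v))
  ext x
  · simpa using h0
  · simpa using h2 x

/-- Evaluation at `0` identifies `ℝ × 𝓛` with `ℝ × V`. There the orbit of the origin differs from
the image of `Σ` only by a continuous quadratic shear in `v`, which preserves both finiteness over
compact sets and boundedness. -/
theorem IsLagrangian.isLatticeIn (hL : D.IsLagrangian (D.L Γ))
    (hP : ∀ K : Set (ℝ × ℝ × V), IsCompact K → {a | a ∈ Γ ∧ ∃ x ∈ K, a • x ∈ K}.Finite)
    (hC : ∃ K : Set (ℝ × ℝ × V), IsCompact K ∧ ∀ x, ∃ a ∈ Γ, a • x ∈ K) :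
    IsLatticeIn (W := ℝ × D.L Γ) hL.sigAddSubgroup := by
  have hsurj := exists_mem_L_apply_eq (span_LamAt hC 0)
  obtain ⟨e, he⟩ := exists_evalEquiv
    (fun w hw => hL.eq_zero_of_apply_eq_zero (t := 0) hsurj hw) hsurj
  -- On `𝓛` the value at `0` determines the derivative at `0`, and `B` is this dependence.
  let B : V →ₗ[ℝ] V := D.derivAt 0 ∘ₗ (D.L Γ).subtype ∘ₗ (e.symm : V →ₗ[ℝ] D.L Γ)
  have hB : ∀ w ∈ D.L Γ, deriv (w : ℝ → V) 0 = B ((w : ℝ → V) 0) := by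
    intro w hw
    have h1 : e.symm ((w : ℝ → V) 0) = ⟨w, hw⟩ := by
      rw [LinearEquiv.symm_apply_eq, he]
    simp [B, h1]
  let e' : (ℝ × D.L Γ) ≃ₗ[ℝ] ℝ × V := (LinearEquiv.refl ℝ ℝ).prodCongr e
  let S' : AddSubgroup (ℝ × V) := hL.sigAddSubgroup.map (e' : ℝ × D.L Γ →+ ℝ × V)
  have hS' : ∀ x, x ∈ S' ↔ ∃ a ∈ D.Sig Γ, x = (a.q, (a.u : ℝ → V) 0) := by
    intro x
    constructor
    · rintro ⟨y, hy, rfl⟩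
      exact ⟨_, hy, Prod.ext rfl (he _)⟩
    · rintro ⟨a, ha, rfl⟩
      obtain ⟨y, hy, hye⟩ := exists_mem_SigSet _ _ ha
      exact ⟨y, hy, Prod.ext (congrArg G.q hye)
        ((he _).trans (congrArg (fun b : D.G => (b.u : ℝ → V) 0) hye))⟩
  have hu : ∀ a ∈ D.Sig Γ, a.u ∈ D.L Γ := fun a ha =>
    Submodule.subset_span ((D.mem_Lam Γ _).2 ⟨a, ha, rfl⟩)
  refine IsLatticeIn.of_map e' (S' := S') (fun x => ?_) (isLatticeIn_of_finite_inter S' ?_ ?_)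
  · exact (AddSubgroup.mem_map_iff_mem e'.injective).symm
  · intro K hK
    have hBc : Continuous B := B.continuous_of_finiteDimensional
    have hc : Continuous fun x : ℝ × V => (x.1 - D.form (B x.2) x.2, x.2) :=
      (continuous_fst.sub (D.continuous_form (hBc.comp continuous_snd) continuous_snd)).prodMk
        continuous_snd
    refine ((finite_Sig_of_isCompact hP 0 (hK.image hc)).image
      fun a => (a.q, (a.u : ℝ → V) 0)).subset ?_
    rintro x ⟨hx, hxK⟩
    obtain ⟨a, ha, rfl⟩ := (hS' x).1 hx
    refine ⟨a, ⟨ha, _, hxK, ?_⟩, rfl⟩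
    simp only [hB _ (hu a ha)]
  · obtain ⟨C, hC'⟩ := exists_isCompact_slice hC 0
    have hBbd : ∃ C', ∀ v : V, ‖v‖ ≤ C → |D.form (B v) v| ≤ C' := by
      have : ProperSpace V := FiniteDimensional.proper ℝ V
      have hBc : Continuous B := B.continuous_of_finiteDimensional
      obtain ⟨C', hC'⟩ := (isCompact_closedBall (0 : V) C).exists_bound_of_continuousOn
        (D.continuous_form hBc continuous_id).continuousOn
      exact ⟨C', fun v hv => hC' v (by simpa using hv)⟩
    obtain ⟨C', hB'⟩ := hBbd
    -- Here `C'` bounds the quadratic correction `⟨Bv, v⟩` on the ball of radius `C`.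
    refine span_eq_top_of_slice (C := max C (C + C')) ?_ fun s => ?_
    · rw [← span_LamAt hC 0]
      congr 1
      ext v
      simp only [Set.mem_image, SetLike.mem_coe, mem_LamAt, hS']
      constructor
      · rintro ⟨_, ⟨a, ha, rfl⟩, rfl⟩
        exact ⟨a, ha, rfl⟩
      · rintro ⟨a, ha, rfl⟩
        exact ⟨_, ⟨a, ha, rfl⟩, rfl⟩
    · obtain ⟨a, ha, h1, h2⟩ := hC' s 0
      simp only [smul_zero, zero_add] at h1 h2
      refine ⟨_, (hS' _).2 ⟨a, ha, rfl⟩, ?_, h2.trans (le_max_left _ _)⟩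
      have h3 := hB' _ h2
      rw [hB _ (hu a ha)] at h1
      refine le_max_of_le_right ?_
      dsimp only
      rw [abs_le] at *
      constructor <;> linarith [h1.1, h1.2, h3.1, h3.2]

/-! ### The case of infinite cyclic `Ξ` -/

/-- Multiplication by `Ξ` shifts `q` by multiples of `θ` without changing `u`, so each value `u(t)`
has a representative in `Σ` sending the origin of the slice into `[0, θ] × V`. Finiteness in the
slice thus becomes finiteness in `V`. -/
theorem isLatticeIn_LamAt
    (hP : ∀ K : Set (ℝ × ℝ × V), IsCompact K → {a | a ∈ Γ ∧ ∃ x ∈ K, a • x ∈ K}.Finite)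
    (hC : ∃ K : Set (ℝ × ℝ × V), IsCompact K ∧ ∀ x, ∃ a ∈ Γ, a • x ∈ K)
    {θ : ℝ} (hθ : 0 < θ) (hXi : (⟨0, θ, 0⟩ : D.G) ∈ Γ) (t : ℝ) : IsLatticeIn (D.LamAt Γ t) := by
  have hl : ∀ l : ℤ, (⟨0, l * θ, 0⟩ : D.G) ∈ Γ := by
    intro l
    have h : ∀ j : ℕ, (⟨0, θ, 0⟩ : D.G) ^ j = ⟨0, j * θ, 0⟩ := by
      intro j
      induction j with
      | zero => ext1 <;> simp
      | succ j ih =>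
        rw [pow_succ, ih]
        ext1
        · simp
        · simp only [G.mul_q, D.Omega_zero_left]
          push_cast
          ring
        · simp
    rcases Int.eq_nat_or_neg l with ⟨j, rfl | rfl⟩
    · rw [Int.cast_natCast, ← h]
      exact Γ.pow_mem hXi j
    · have e : (⟨0, ((-(j : ℤ) : ℤ) : ℝ) * θ, 0⟩ : D.G) = ((⟨0, θ, 0⟩ : D.G) ^ j)⁻¹ := by
        rw [h]
        ext1 <;> simp
      rw [e]
      exact Γ.inv_mem (Γ.pow_mem hXi j)
  refine isLatticeIn_of_finite_inter _ (fun K hK => ?_) (span_LamAt hC t)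
  refine ((finite_Sig_of_isCompact hP t ((isCompact_Icc (a := 0) (b := θ)).prod hK)).image
    fun a => (a.u : ℝ → V) t).subset ?_
  rintro x ⟨hx, hxK⟩
  obtain ⟨a, ha, rfl⟩ := (D.mem_LamAt Γ t x).1 hx
  let r := a.q - D.form (deriv (a.u : ℝ → V) t) ((a.u : ℝ → V) t)
  have hmul : (⟨0, ((-⌊r / θ⌋ : ℤ) : ℝ) * θ, 0⟩ * a : D.G)
      = ⟨a.k, a.q - ⌊r / θ⌋ * θ, a.u⟩ := by
    ext1
    · simp
    · simp only [G.mul_q, D.Omega_zero_left]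
      push_cast
      ring
    · simp
  refine ⟨⟨a.k, a.q - ⌊r / θ⌋ * θ, a.u⟩, ⟨⟨?_, ha.2⟩, ?_, hxK⟩, rfl⟩
  · rw [← hmul]
    exact Γ.mul_mem (hl _) ha.1
  · have h1 := Int.floor_le (r / θ)
    have h2 := (Int.lt_floor_add_one (r / θ)).le
    rw [le_div_iff₀ hθ] at h1
    rw [div_le_iff₀ hθ] at h2
    have hr : r = a.q - D.form (deriv (a.u : ℝ → V) t) ((a.u : ℝ → V) t) := rfl
    constructor <;> dsimp only <;> linarith

/-- Lifting a lattice basis to `Λ` defines a linear section `s` of evaluation that maps `Δ_t(Σ)`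
into `Λ`. For `c ∈ Λ`, the element `s(c(t)) - c` of `Λ` vanishes at `t`, so freeness makes it zero;
by linearity `s(w(t)) = w` on all of `𝓛`. -/
theorem ActsFreely.eq_zero_of_isLatticeIn (hfree : D.ActsFreely Γ) {t : ℝ}
    (hlat : IsLatticeIn (D.LamAt Γ t)) {w : D.E} (hw : w ∈ D.L Γ) (h : (w : ℝ → V) t = 0) :
    w = 0 := by
  obtain ⟨d, b, hb⟩ := hlat
  have hbm : ∀ i, ∃ a ∈ D.Sig Γ, (a.u : ℝ → V) t = b i := fun i =>
    (D.mem_LamAt Γ t _).1 (by rw [hb]; exact AddSubgroup.subset_closure ⟨i, rfl⟩)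
  choose a ha hab using hbm
  let s : V →ₗ[ℝ] D.E := b.constr ℝ fun i => (a i).u
  have hsb : ∀ i, s (b i) = (a i).u := fun i => b.constr_basis ℝ _ i
  have hsec : D.evalAt t ∘ₗ s = LinearMap.id := b.ext fun i => by simp [hsb, hab]
  have hsΛ : D.LamAt Γ t ≤ (D.Lam Γ).comap (s : V →+ D.E) := by
    rw [hb, AddSubgroup.closure_le]
    rintro _ ⟨i, rfl⟩
    exact (D.mem_Lam Γ _).2 ⟨a i, ha i, (hsb i).symm⟩
  have hle : D.L Γ ≤ LinearMap.eqLocus (s ∘ₗ D.evalAt t) LinearMap.id := by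
    refine Submodule.span_le.2 fun x hx => ?_
    obtain ⟨c, hc, rfl⟩ := (D.mem_Lam Γ x).1 hx
    have h1 : s ((c.u : ℝ → V) t) ∈ D.Lam Γ := hsΛ ((D.mem_LamAt Γ t _).2 ⟨c, hc, rfl⟩)
    obtain ⟨y, hy, hye⟩ := (D.mem_Lam Γ _).1 ((D.Lam Γ).sub_mem h1 hx)
    have h2 : (y.u : ℝ → V) t = 0 := by
      have h3 : D.evalAt t (s ((c.u : ℝ → V) t)) = (c.u : ℝ → V) t := LinearMap.congr_fun hsec _
      rw [hye, ← evalAt_apply, map_sub, h3, evalAt_apply, sub_self]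
    have h4 := hfree.u_eq_zero hy h2
    rw [hye, sub_eq_zero] at h4
    exact h4
  have h5 : s ((w : ℝ → V) t) = w := hle hw
  rw [← h5, h, map_zero]

end ConformalData

/-! ### The theorem, with the dichotomy `θ = 0` or `θ > 0`. -/

theorem theorem4p2 {V : Type*} [NormedAddCommGroup V] [NormedSpace ℝ V] [FiniteDimensional ℝ V]
    (D : ConformalData V) (Γ : Subgroup D.G) (hfree : D.ActsFreely Γ)
    {M : Type*} [TopologicalSpace M] [T2Space M] [ChartedSpace (ℝ × ℝ × V) M]
    [IsManifold (modelWithCornersSelf ℝ (ℝ × ℝ × V)) ∞ M]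
    (π : ℝ × ℝ × V → M) (hπ : D.IsQuotientMapOf Γ π) [CompactSpace M] :
    -- `Δ_t(Σ)` spans `V`
    (∀ t : ℝ, Submodule.span ℝ (D.LamAt Γ t : Set V) = ⊤) ∧
    -- `Σ ∩ Ker Δ_t = Ξ`
    (∀ t : ℝ, D.Sig Γ ⊓ D.kerDeltaAt t = D.Xi Γ) ∧
    -- `Ξ = {0} × ℤθ × {0}`, and `2 Ω` is `ℤθ`-valued on `Λ`
    (∃ θ : ℝ, 0 ≤ θ ∧
      (D.Xi Γ : Set D.G) = {a | ∃ l : ℤ, a = ⟨0, l * θ, 0⟩} ∧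
      ∀ u ∈ D.Lam Γ, ∀ w ∈ D.Lam Γ, ∃ l : ℤ, 2 * D.Omega u w = l * θ) ∧
    -- invariance of `Λ`, `𝓛` and `Σ`
    (∀ (k : ℤ) (q : ℝ) (u : D.E), (⟨k, q, u⟩ : D.G) ∈ Γ →
      (D.T ^ k) '' (D.Lam Γ : Set D.E) = D.Lam Γ ∧
      ∃ h : (D.L Γ).map ((D.T ^ k : D.E ≃ₗ[ℝ] D.E) : D.E →ₗ[ℝ] D.E) = D.L Γ,
        D.Psi Γ k u h '' D.SigSet Γ = D.SigSet Γ) ∧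
    -- an Abelian subgroup of finite index forces some `T^k`, `k ≥ 1`, to be trivial on `𝓛`
    ((∃ H : Subgroup Γ, IsMulCommutative H ∧ H.FiniteIndex) →
      ∃ (k : ℤ) (q : ℝ) (u : D.E), (⟨k, q, u⟩ : D.G) ∈ Γ ∧ 1 ≤ k ∧
        ∀ w ∈ D.L Γ, (D.T ^ k) w = w) ∧
    -- `𝓛` is a first-order subspace
    D.IsFirstOrder (D.L Γ) ∧
    -- the two cases: `Ξ` trivial, or `Ξ` infinite cyclic
    ((D.Xi Γ = ⊥ ∧ D.IsLagrangian (D.L Γ) ∧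
        ∃ S : AddSubgroup (ℝ × D.L Γ), (S : Set (ℝ × D.L Γ)) = D.SigSet Γ ∧ IsLatticeIn (W := ℝ × D.L Γ) S ∧
          ∃ e : S ≃+ D.Lam Γ, ∀ x : S, (e x : D.E) = (x : ℝ × D.L Γ).2) ∨
      (Nonempty (D.Xi Γ ≃* Multiplicative ℤ) ∧
        IsLatticeIn (D.LamInL Γ))) := by
  have hP : ∀ K : Set (ℝ × ℝ × V), IsCompact K → {a | a ∈ Γ ∧ ∃ x ∈ K, a • x ∈ K}.Finite :=
    fun K hK => hfree.finite_smul_inter hπ hK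
  have hC := hπ.exists_isCompact
  have hspan := ConformalData.span_LamAt hC
  have hsurj := fun t => ConformalData.exists_mem_L_apply_eq (hspan t)
  obtain ⟨θ, hθ, hXi⟩ := ConformalData.exists_Xi_eq hP
  have hOm : ∀ u ∈ D.Lam Γ, ∀ w ∈ D.Lam Γ, ∃ l : ℤ, 2 * D.Omega u w = l * θ := by
    intro u hu w hw
    obtain ⟨a, ha, rfl⟩ := (D.mem_Lam Γ u).1 hu
    obtain ⟨b, hb, rfl⟩ := (D.mem_Lam Γ w).1 hw
    have h : (⟨0, 2 * D.Omega a.u b.u, 0⟩ : D.G) ∈ (D.Xi Γ : Set D.G) :=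
      ConformalData.commutator_mem_Xi ha hb
    rw [hXi] at h
    obtain ⟨l, hl⟩ := h
    exact ⟨l, congrArg ConformalData.G.q hl⟩
  refine ⟨hspan, hfree.Sig_inf_kerDeltaAt, ⟨θ, hθ, hXi, hOm⟩, ?_, ?_, ?_⟩
  · intro k q u hg
    exact ⟨ConformalData.T_zpow_image_Lam hg, ConformalData.map_T_zpow_L hg,
      ConformalData.Psi_image_SigSet hg _⟩
  · rintro ⟨H, hH, hH'⟩
    obtain ⟨g, hg, hgk, h⟩ :=
      ConformalData.exists_T_zpow_eq_id (ConformalData.exists_mem_one_le_k hC) H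
    exact ⟨g.k, g.q, g.u, hg, hgk, h⟩
  rcases hθ.eq_or_lt with rfl | hθ
  · have hL : D.IsLagrangian (D.L Γ) := ConformalData.isLagrangian_L fun u hu w hw => by
      obtain ⟨l, hl⟩ := hOm u hu w hw
      linarith
    have hbot : D.Xi Γ = ⊥ := by
      refine (Subgroup.eq_bot_iff_forall _).2 fun a ha => ?_
      have ha' : a ∈ (D.Xi Γ : Set D.G) := ha
      rw [hXi] at ha'
      obtain ⟨l, rfl⟩ := ha'
      rw [mul_zero]
      rfl
    exact ⟨ConformalData.isFirstOrder_of_evalEquiv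
        (fun t w hw => hL.eq_zero_of_apply_eq_zero (hsurj t) hw) (hsurj 0),
      Or.inl ⟨hbot, hL, hL.sigAddSubgroup, rfl, hL.isLatticeIn hP hC, hL.exists_addEquiv hbot⟩⟩
  · have hmem : ∀ l : ℤ, (⟨0, l * θ, 0⟩ : D.G) ∈ D.Xi Γ := by
      intro l
      have h : (⟨0, l * θ, 0⟩ : D.G) ∈ (D.Xi Γ : Set D.G) := by
        rw [hXi]
        exact ⟨l, rfl⟩
      exact h
    have hlat := ConformalData.isLatticeIn_LamAt hP hC hθ
      (by simpa using (ConformalData.mem_Xi.1 (hmem 1)).1)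
    have hinj : ∀ t, ∀ w ∈ D.L Γ, (w : ℝ → V) t = 0 → w = 0 :=
      fun t w hw => hfree.eq_zero_of_isLatticeIn (hlat t) hw
    refine ⟨ConformalData.isFirstOrder_of_evalEquiv hinj (hsurj 0), Or.inr ⟨?_, ?_⟩⟩
    · let F : Multiplicative ℤ →* D.Xi Γ :=
        { toFun := fun l => ⟨⟨0, (l.toAdd : ℤ) * θ, 0⟩, hmem _⟩
          map_one' := by
            refine Subtype.ext ?_
            ext1 <;> simp
          map_mul' := fun l m => by
            refine Subtype.ext ?_
            ext1
            · simp
            · simp [D.Omega_zero_left, add_mul]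
            · simp }
      refine ⟨(MulEquiv.ofBijective F ⟨fun l m h => ?_, fun a => ?_⟩).symm⟩
      · have h1 : ((l.toAdd : ℤ) : ℝ) * θ = (m.toAdd : ℤ) * θ :=
          congrArg (fun x : D.Xi Γ => (x : D.G).q) h
        exact Multiplicative.toAdd.injective (by exact_mod_cast mul_right_cancel₀ hθ.ne' h1)
      · have ha : (a : D.G) ∈ (D.Xi Γ : Set D.G) := a.2
        rw [hXi] at ha
        obtain ⟨l, hl⟩ := ha
        exact ⟨Multiplicative.ofAdd l, Subtype.ext hl.symm⟩
    · obtain ⟨e, he⟩ := ConformalData.exists_evalEquiv (hinj 0) (hsurj 0)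
      -- Evaluation at `0` carries `Λ` onto the lattice `Δ_0(Σ)`; its injectivity on `𝓛` ensures
      -- that only elements of `Λ` land there.
      refine IsLatticeIn.of_map e (fun x => ?_) (hlat 0)
      rw [he, D.mem_LamAt]
      constructor
      · intro hx
        obtain ⟨a, ha, hax⟩ := (D.mem_Lam Γ _).1 hx
        exact ⟨a, ha, by rw [hax]⟩
      · rintro ⟨a, ha, hax⟩
        have hmL : a.u ∈ D.Lam Γ := (D.mem_Lam Γ _).2 ⟨a, ha, rfl⟩
        have h0 := hinj 0 (a.u - x) ((D.L Γ).sub_mem (Submodule.subset_span hmL) x.2)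
          (sub_eq_zero.2 hax)
        rw [sub_eq_zero] at h0
        change (x : D.E) ∈ D.Lam Γ
        rwa [← h0]
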